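/- Let $\mathcal W\subseteq\mathbb R^d$ be a non-empty bounded polyhedron, let $z$ be a random variable with distribution $\mathbb P$, let $f(w,z)$ be integrable in $z$ for each $w\in\mathcal W$, and suppose that $P(w)=\mathbb E_{z\sim\mathbb P}[f(w,z)]$ is piecewise linear on $\mathcal W$ (i.e. $\mathcal W$ is covered by finitely many polyhedra, and $P$ is affine on the part of $\mathcal W$ in each of them). Let $P_*=\min_{\mathcal W}P$ and $\mathcal W_*=\arg\min_{\mathcal W}P$, and for $w\in\mathcal W$ let $w^*$ be a point of $\mathcal W_*$ closest to $w$ in the Euclidean norm. Let $z_1,z_2,\dots$ be i.i.d. samples from $\mathbb P$. (1) There is $\kappa>0$ with $\|w-w^*\|_2\le\kappa\,(P(w)-P_*)$ for all $w\in\mathcal W$ (weak sharp minima), and there is $\alpha>0$ with $\|w-w^*\|_2^2\le\alpha\,(P(w)-P_*)$ for all $w\in\mathcal W$, i.e. the problem satisfies EBC$(\theta=1,\alpha)$. Suppose in addition that $|f(w,z)-f(u,z)|\le G\|w-u\|_2$ for all $w,u\in\mathcal W$ and all $z$, where $G>0$, and let $\delta\in(0,1)$. Let $R$ be such that $\|w\|_2\le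 R$ on $\mathcal W$. (2) ERM, rate $\widetilde O(d/n)$. If EBC$(1,\alpha)$ holds and $n\ge2$, then with probability at least $1-\delta$ every minimizer $\widehat w$ over $\mathcal W$ of $P_n(w)=\frac1n\sum_{i=1}^n f(w,z_i)$ satisfies $$P(\widehat w)-P_*\le C_1\,\frac{d\log n+\log(1/\delta)}{n},$$ where $C_1$ depends only on $\alpha,G,R$. (3) ASA, rate $\widetilde O(1/n)$. Assume that $P$ is convex and that EBC$(1,\alpha)$ holds. Let $g(w,z)$ be a measurable stochastic subgradient with $\|g\|_2\le G$: for each $w\in\mathcal W$, $g(w,z)$ is a subgradient of $f(\cdot,z)$ at $w$ for all $z$ or, more generally, $\mathbb E_z[g(w,z)]$ is a subgradient of $P$ at $w$ (subgradients relative to $\mathcal W$; in the regular sense for a non-convex function). For $n\ge100$, $w_1\in\mathcal W$ and $\|w_1-w_1^*\|_2\le R_0$, put $m=\lfloor\frac12\log_2\frac{2n}{\log_2 n}\rfloor-1$, $n_0=\lfloor n/m\rfloor$, $\widehat w_0=w_1$. In stage $k=1,\dots,m$, with $R_{k-1}=R_0/2^{k-1}$ and $\gamma_k=R_{k-1}/(G\sqrt{n_0+1})$,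 run $n_0$ steps $v_{t+1}=\Pi(v_t-\gamma_k g(v_t,z))$ from $v_1=\widehat w_{k-1}$, each with a fresh sample $z$, where $\Pi$ is the Euclidean projection onto $\mathcal W\cap\{u:\|u-\widehat w_{k-1}\|_2\le R_{k-1}\}$, and let $\widehat w_k=\frac1{n_0+1}\sum_{t=1}^{n_0+1}v_t$. Then with probability at least $1-\delta$ $$P(\widehat w_m)-P_*\le C_2\max(\alpha G^2,R_0G)\,\frac{\log n\,\log(\log n/\delta)}{n},$$ where $C_2$ is an absolute constant. (4) ERM with non-negative linear losses, rate $\widetilde O((d/n)^2+dP_*/n)$. If moreover $f(w,z)\ge0$ on $\mathcal W$ and each $f(\cdot,z)$ is affine on $\mathcal W$, and if $n\ge2$ and $n\ge C_3\,d\log n$, then with probability at least $1-\delta$ every minimizer $\widehat w$ of $P_n$ over $\mathcal W$ satisfies $$P(\widehat w)-P_*\le C_3\left(\Big(\frac{d\log n+\log(1/\delta)}{n}\Big)^2+\frac{(d\log n+\log(1/\delta))P_*}{n}\right),$$ where $C_3$ depends only on $G,R$ and a constant $\kappa$ as in (1). -/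

import Mathlib

open MeasureTheory

noncomputable section

namespace FastRates

variable {E : Type*} [NormedAddCommGroup E] [InnerProductSpace ℝ E]
variable {Z : Type*} [MeasurableSpace Z]

/-- A polyhedron: the solution set of finitely many linear inequalities. -/
def IsPolyhedron (S : Set E) : Prop :=
  ∃ (m : ℕ) (a : Fin m → E) (b : Fin m → ℝ), S = {w | ∀ i, inner ℝ (a i) w ≤ b i}

/-- `h` agrees on `S` with an affine function. -/
def IsAffineOn (h : E → ℝ) (S : Set E) : Prop :=
  ∃ (a : E) (b : ℝ), ∀ w ∈ S, h w = inner ℝ a w + b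

/-- `h` is piecewise linear on `W`: finitely many polyhedra cover `W`, and `h` is affine on the
part of `W` in each of them. -/
def IsPiecewiseLinearOn (h : E → ℝ) (W : Set E) : Prop :=
  ∃ (N : ℕ) (Q : Fin N → Set E), (∀ j, IsPolyhedron (Q j)) ∧ W ⊆ ⋃ j, Q j ∧
    ∀ j, IsAffineOn h (W ∩ Q j)

/-- The risk `P(w) = 𝔼[f(w, z)]`, `z ∼ μ`. -/
def risk (μ : Measure Z) (f : E → Z → ℝ) (w : E) : ℝ := ∫ z, f w z ∂μ

/-- The empirical risk `P_n(w)` of the first `n` samples. -/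
def empRisk (f : E → Z → ℝ) (n : ℕ) (z : ℕ → Z) (w : E) : ℝ :=
  (1 / (n : ℝ)) * ∑ i ∈ Finset.range n, f w (z i)

/-- The set of minimizers of `h` over `W`. -/
def argminOn (h : E → ℝ) (W : Set E) : Set E := {w | w ∈ W ∧ ∀ u ∈ W, h w ≤ h u}

/-- The optimal value of `h` over `W`. -/
def minValue (h : E → ℝ) (W : Set E) : ℝ := sInf (h '' W)

/-- `y` is a point of `K` closest to `x`. -/
def IsNearest (K : Set E) (x y : E) : Prop := y ∈ K ∧ ∀ u ∈ K, ‖x - y‖ ≤ ‖x - u‖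

/-- The error bound condition EBC(θ, α) for minimizing `P` over `W`: for each `w ∈ W` there is
a minimizer `v` closest to `w`, and `‖w - v‖² ≤ α (P(w) - P(v))^θ`. -/
def EBC (P : E → ℝ) (W : Set E) (θ α : ℝ) : Prop :=
  ∀ w ∈ W, ∃ v, IsNearest (argminOn P W) w v ∧ ‖w - v‖ ^ 2 ≤ α * (P w - P v) ^ θ

/-- Weak sharp minima with modulus `κ`: for each `w ∈ W` there is a minimizer `v` closest to
`w`, and `‖w - v‖ ≤ κ (P(w) - P(v))`. -/
def WeakSharpMinima (P : E → ℝ) (W : Set E) (κ : ℝ) : Prop :=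
  ∀ w ∈ W, ∃ v, IsNearest (argminOn P W) w v ∧ ‖w - v‖ ≤ κ * (P w - P v)

/-- The loss is `G`-Lipschitz in `w ∈ W`, for each data point. -/
def IsLipschitzLoss (f : E → Z → ℝ) (W : Set E) (G : ℝ) : Prop :=
  ∀ z, ∀ w ∈ W, ∀ u ∈ W, |f w z - f u z| ≤ G * ‖w - u‖

/-- The (regular) subdifferential at `w` of a function on `W`, convex or not. For a convex
function on a convex `W` these are the usual subgradients,
`h(u) ≥ h(w) + ⟨v, u - w⟩` for all `u ∈ W`; see `mem_subdiff_iff`. -/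
def subdiff (h : E → ℝ) (W : Set E) (w : E) : Set E :=
  {v | ∀ ε > 0, ∀ᶠ u in nhdsWithin w W, h w + inner ℝ v (u - w) - ε * ‖u - w‖ ≤ h u}

theorem mem_subdiff_iff {h : E → ℝ} {W : Set E} (hh : ConvexOn ℝ W h) {w v : E} (hw : w ∈ W) :
    v ∈ subdiff h W w ↔ ∀ u ∈ W, h w + inner ℝ v (u - w) ≤ h u := by
  constructor
  · intro hv u hu
    refine le_of_forall_pos_le_add fun η hη => ?_
    have hε : 0 < η / (‖u - w‖ + 1) := by positivity
    have htend : Filter.Tendsto (fun t : ℝ => w + t • (u - w)) (nhdsWithin 0 (Set.Ioo 0 1))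
        (nhdsWithin w W) := by
      refine tendsto_nhdsWithin_iff.2 ⟨?_, ?_⟩
      · have hc : Continuous fun t : ℝ => w + t • (u - w) := by fun_prop
        have := hc.tendsto 0
        simp only [zero_smul, add_zero] at this
        exact this.mono_left nhdsWithin_le_nhds
      · filter_upwards [self_mem_nhdsWithin] with t ht
        exact hh.1.add_smul_sub_mem hw hu ⟨ht.1.le, ht.2.le⟩
    have hne : (nhdsWithin (0 : ℝ) (Set.Ioo 0 1)).NeBot :=
      mem_closure_iff_nhdsWithin_neBot.1 (by rw [closure_Ioo (by norm_num)]; simp)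
    obtain ⟨t, ht, htm⟩ := ((htend.eventually (hv _ hε)).and self_mem_nhdsWithin).exists
    simp only [add_sub_cancel_left, inner_smul_right, norm_smul, Real.norm_eq_abs,
      abs_of_pos htm.1] at ht
    have hcv := hh.2 hw hu (by linarith [htm.2] : 0 ≤ 1 - t) htm.1.le (by ring)
    have he : (1 - t) • w + t • u = w + t • (u - w) := by module
    rw [he] at hcv
    simp only [smul_eq_mul] at hcv
    have hb : η / (‖u - w‖ + 1) * ‖u - w‖ ≤ η := by
      rw [div_mul_eq_mul_div, div_le_iff₀ (by positivity)]
      nlinarith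
    have h1 : t * (h w + inner ℝ v (u - w) - η / (‖u - w‖ + 1) * ‖u - w‖) ≤ t * h u := by
      nlinarith
    have h2 := le_of_mul_le_mul_left h1 htm.1
    linarith
  · intro hv ε hε
    filter_upwards [self_mem_nhdsWithin] with u hu
    have := hv u hu
    have := mul_nonneg hε.le (norm_nonneg (u - w))
    linarith

/-- A measurable stochastic subgradient oracle `g` for minimizing `𝔼[f(w, z)]` over `W`, with
norm at most `G`. At each `w ∈ W`, either `g(w, z)` is a subgradient of `f(·, z)` for each `z`
or, more generally, `g(w, z)` is an unbiased estimate of a subgradient of the risk. -/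
def IsSubgradientOracle [MeasurableSpace E] (μ : Measure Z) (f : E → Z → ℝ) (W : Set E) (G : ℝ)
    (g : E → Z → E) : Prop :=
  Measurable (Function.uncurry g) ∧ ∀ w ∈ W, (∀ z, ‖g w z‖ ≤ G) ∧
    ((∀ z, g w z ∈ subdiff (fun u => f u z) W w) ∨
      (∫ z, g w z ∂μ) ∈ subdiff (risk μ f) W w)

open Classical in
/-- Euclidean projection of `x` onto `K` (a closest point, if there is one). -/
def proj (K : Set E) (x : E) : E := if h : ∃ y, IsNearest K x y then h.choose else x

/-- The iterates of the projected stochastic subgradient method on `K` with step size `γ`,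
started at `w₁` (index `0` here). -/
def ssgIter (g : E → Z → E) (K : Set E) (γ : ℝ) (w₁ : E) (z : ℕ → Z) : ℕ → E
  | 0 => w₁
  | t + 1 => proj K (ssgIter g K γ w₁ z t - γ • g (ssgIter g K γ w₁ z t) (z t))

/-- The method SSG: the average of the first iterate and the `T` following ones. -/
def ssg (g : E → Z → E) (K : Set E) (γ : ℝ) (w₁ : E) (z : ℕ → Z) (T : ℕ) : E :=
  (1 / ((T : ℝ) + 1)) • ∑ t ∈ Finset.range (T + 1), ssgIter g K γ w₁ z t

/-- The number of stages `m = ⌊(1/2) log₂ (2n / log₂ n)⌋ - 1` of ASA. -/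
def asaStages (n : ℕ) : ℕ := ⌊(1 / 2) * Real.logb 2 (2 * n / Real.logb 2 n)⌋₊ - 1

/-- The number of steps `n₀ = ⌊n / m⌋` in a stage. -/
def asaSteps (n : ℕ) : ℕ := n / asaStages n

/-- The point reached after `k` stages of ASA. The stage that follows it has radius `R₀ / 2 ^ k`,
step size `R₀ / 2 ^ k / (G √(n₀ + 1))`, works on `W ∩ B(ŵ_k, R₀ / 2 ^ k)`, and consumes
the next `n₀` samples. -/
def asaIter (g : E → Z → E) (W : Set E) (G R₀ : ℝ) (n : ℕ) (w₁ : E) (z : ℕ → Z) : ℕ → E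
  | 0 => w₁
  | k + 1 =>
      ssg g (W ∩ Metric.closedBall (asaIter g W G R₀ n w₁ z k) (R₀ / 2 ^ k))
        (R₀ / 2 ^ k / (G * √((asaSteps n : ℝ) + 1))) (asaIter g W G R₀ n w₁ z k)
        (fun t => z (k * asaSteps n + t)) (asaSteps n)

/-- The output of ASA(w₁, n, R₀), which uses at most the first `n` samples. -/
def asa (g : E → Z → E) (W : Set E) (G R₀ : ℝ) (n : ℕ) (w₁ : E) (z : ℕ → Z) : E :=
  asaIter g W G R₀ n w₁ z (asaStages n)

/-- The law of a sequence `z₀, z₁, …` of independent samples from `μ`. -/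
def iidLaw (μ : Measure Z) [IsProbabilityMeasure μ] : Measure (ℕ → Z) :=
  Measure.infinitePi fun _ => μ

end FastRates

end

/-!
A point of a polytope on which `P` is affine is a convex combination of vertices. The excess of the
vertices that are not optimal is bounded below, so replacing them by minimizers moves the point by
at most a multiple of its own excess. This gives weak sharp minima, which boundedness turns into the
error bound condition.

For empirical risk minimization, each point `u` of a net of mesh `d / n ^ 2` is compared with a
nearest minimizer `v`. The loss difference `f u z - f v z` is at most `G * ‖u - v‖`, which the error
bound condition, or weak sharp minima, makes small compared with the excess of `u`. A Chernoff bound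
with a parameter that depends on `u` then gives fast rates. Under weak sharp minima this parameter
can be taken inversely proportional to the excess, and only the mesh of the net limits the rate.

In adaptive stochastic approximation, a stage of radius `r` loses at most about `G * r / √n₀`
against any point it can reach, by the regret bound for projected subgradient steps and a martingale
tail bound. While a minimizer is within reach, this and the error bound condition let the radius be
halved; once it is not, the excess is already of the order aimed at, and the remaining stages lose
only a geometric sum.
-/

noncomputable section

namespace FastRates

open Set Filter
open scoped Topology

section Polyhedra

variable {E : Type*} [NormedAddCommGroup E] [InnerProductSpace ℝ E] {S T : Set E}

theorem IsPolyhedron.isClosed (hS : IsPolyhedron S) : IsClosed S := by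
  obtain ⟨m, a, b, rfl⟩ := hS
  rw [Set.ofPred_forall]
  exact isClosed_iInter fun i => isClosed_le (by fun_prop) continuous_const

theorem IsPolyhedron.convex (hS : IsPolyhedron S) : Convex ℝ S := by
  obtain ⟨m, a, b, rfl⟩ := hS
  rw [Set.ofPred_forall]
  exact convex_iInter fun i => convex_halfSpace_le (innerₗ E (a i)).isLinear (b i)

theorem IsPolyhedron.inter (hS : IsPolyhedron S) (hT : IsPolyhedron T) :
    IsPolyhedron (S ∩ T) := by
  obtain ⟨m, a, b, rfl⟩ := hS
  obtain ⟨k, a', b', rfl⟩ := hT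
  refine ⟨m + k, Fin.append a a', Fin.append b b', ?_⟩
  ext w
  simp [Fin.forall_fin_add]

theorem eventually_forall_inner_add_smul_sub_le {ι : Type*} [Finite ι] {a : ι → E} {b : ι → ℝ}
    {x y : E} (hx : ∀ i, inner ℝ (a i) x ≤ b i)
    (hact : ∀ i, inner ℝ (a i) x = b i → inner ℝ (a i) y = b i) :
    ∀ᶠ t : ℝ in 𝓝 0, ∀ i, inner ℝ (a i) (x + t • (y - x)) ≤ b i := by
  refine eventually_all.2 fun i => ?_
  rcases (hx i).eq_or_lt with hi | hi
  · refine .of_forall fun t => ?_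
    simp [inner_add_right, inner_smul_right, inner_sub_right, hact i hi, hi]
  · have hcont : Continuous fun t : ℝ => inner ℝ (a i) (x + t • (y - x)) := by fun_prop
    exact (hcont.continuousAt.eventually_lt_const (by simpa using hi)).mono fun t => le_of_lt

theorem eq_of_mem_extremePoints_of_eventually {x y : E} (hx : x ∈ S.extremePoints ℝ)
    (hev : ∀ᶠ t : ℝ in 𝓝 0, x + t • (y - x) ∈ S) : x = y := by
  have hneg : ∀ᶠ t : ℝ in 𝓝 0, x + (-t) • (y - x) ∈ S :=
    (continuous_neg.tendsto' (0 : ℝ) 0 neg_zero).eventually hev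
  obtain ⟨t, ⟨hpos, hneg⟩, ht : t ≠ 0⟩ :=
    (((hev.and hneg).filter_mono nhdsWithin_le_nhds).and
      (self_mem_nhdsWithin (s := {0}ᶜ))).exists
  have hmid : midpoint ℝ (x + t • (y - x)) (x + (-t) • (y - x)) = x := by
    rw [midpoint_eq_smul_add, invOf_eq_inv]
    module
  have hseg := midpoint_mem_openSegment (𝕜 := ℝ) (x + t • (y - x)) (x + (-t) • (y - x))
  rw [hmid] at hseg
  have heq := hx.2 hpos hneg hseg
  simpa [ht, sub_eq_zero, eq_comm] using heq

theorem IsPolyhedron.finite_extremePoints (hS : IsPolyhedron S) : (S.extremePoints ℝ).Finite := by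
  obtain ⟨m, a, b, rfl⟩ := hS
  -- An extreme point is determined by its set of active constraints.
  refine Set.Finite.of_injOn (f := fun w => {i | inner ℝ (a i) w = b i}) (mapsTo_univ _ _)
    (fun x hx y _ hxy => ?_) finite_univ
  refine eq_of_mem_extremePoints_of_eventually hx
    (eventually_forall_inner_add_smul_sub_le hx.1 fun i hi => ?_)
  exact (Set.ext_iff.1 hxy i).1 hi

theorem IsPolyhedron.convexHull_extremePoints [FiniteDimensional ℝ E] (hS : IsPolyhedron S)
    (hb : Bornology.IsBounded S) : convexHull ℝ (S.extremePoints ℝ) = S := by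
  rw [← (hS.finite_extremePoints.isClosed_convexHull ℝ).closure_eq]
  exact closure_convexHull_extremePoints (Metric.isCompact_of_isClosed_isBounded hS.isClosed hb)
    hS.convex

theorem eventually_sharp_of_convexHull {V F : Set E} (hV : V.Finite) (φ : E →ₗ[ℝ] ℝ) {c : ℝ}
    (hc : ∀ v ∈ V, c ≤ φ v) (hF : Convex ℝ F) (hne : F.Nonempty) (hVF : ∀ v ∈ V, φ v = c → v ∈ F) :
    ∀ᶠ κ in atTop, ∀ w ∈ convexHull ℝ V, ∃ v ∈ F, ‖w - v‖ ≤ κ * (φ w - c) := by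
  obtain ⟨w₀, hw₀⟩ := hne
  have hvertices : ∀ᶠ κ in atTop, ∀ w ∈ V, ∃ v ∈ F, ‖w - v‖ ≤ κ * (φ w - c) := by
    refine (eventually_all_finite hV).2 fun w hw => ?_
    rcases (hc w hw).eq_or_lt with heq | hlt
    · exact .of_forall fun κ => ⟨w, hVF w hw heq.symm, by simp [heq]⟩
    · filter_upwards [eventually_ge_atTop (‖w - w₀‖ / (φ w - c))] with κ hκ
      exact ⟨w₀, hw₀, (div_le_iff₀ (sub_pos.2 hlt)).1 hκ⟩
  filter_upwards [hvertices] with κ hκ w hw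
  refine convexHull_min hκ ?_ hw
  rintro x ⟨p, hp, hxp⟩ y ⟨q, hq, hyq⟩ s t hs ht hst
  refine ⟨s • p + t • q, hF hp hq hs ht hst, ?_⟩
  calc ‖s • x + t • y - (s • p + t • q)‖ = ‖s • (x - p) + t • (y - q)‖ := by congr 1; module
    _ ≤ s * ‖x - p‖ + t * ‖y - q‖ := by
      simpa [norm_smul, abs_of_nonneg hs, abs_of_nonneg ht] using
        norm_add_le (s • (x - p)) (t • (y - q))
    _ ≤ s * (κ * (φ x - c)) + t * (κ * (φ y - c)) := by gcongr
    _ = κ * (φ (s • x + t • y) - c) := by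
      simp only [map_add, map_smul, smul_eq_mul]
      linear_combination (- κ * c) * hst

theorem IsPolyhedron.eventually_sharp [FiniteDimensional ℝ E] (hS : IsPolyhedron S)
    (hb : Bornology.IsBounded S) {h : E → ℝ} (hh : IsAffineOn h S) {p : ℝ}
    (hp : ∀ w ∈ S, p ≤ h w) {A : Set E} (hA : A.Nonempty) (hSA : ∀ v ∈ S, h v = p → v ∈ A) :
    ∀ᶠ κ in atTop, ∀ w ∈ S, ∃ v ∈ A, ‖w - v‖ ≤ κ * (h w - p) := by
  obtain ⟨a, b, hab⟩ := hh
  obtain ⟨F, hF, hne, hFA, hSF⟩ : ∃ F : Set E, Convex ℝ F ∧ F.Nonempty ∧ F ⊆ A ∧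
      ∀ v ∈ S, inner ℝ a v = p - b → v ∈ F := by
    rcases {v ∈ S | inner ℝ a v = p - b}.eq_empty_or_nonempty with hempty | hne
    · obtain ⟨v₀, hv₀⟩ := hA
      exact ⟨{v₀}, convex_singleton v₀, singleton_nonempty v₀, singleton_subset_iff.2 hv₀,
        fun v hv heq => absurd ⟨hv, heq⟩ (eq_empty_iff_forall_notMem.1 hempty v)⟩
    · refine ⟨_, hS.convex.inter (convex_hyperplane (innerₗ E a).isLinear (p - b)), hne,
        fun v hv => hSA v hv.1 ?_, fun v hv heq => ⟨hv, heq⟩⟩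
      linarith [hab v hv.1, show inner ℝ a v = p - b from hv.2]
  have hsharp := eventually_sharp_of_convexHull hS.finite_extremePoints (innerₗ E a)
    (c := p - b) (fun v hv => ?_) hF hne fun v hv => hSF v (extremePoints_subset hv)
  · filter_upwards [hsharp] with κ hκ w hw
    rw [hS.convexHull_extremePoints hb] at hκ
    obtain ⟨v, hv, hle⟩ := hκ w hw
    refine ⟨v, hFA hv, hle.trans_eq ?_⟩
    rw [hab w hw, innerₗ_apply_apply]
    ring
  · have hv := extremePoints_subset hv
    rw [innerₗ_apply_apply]
    linarith [hab v hv, hp v hv]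

end Polyhedra

section Minimizers

theorem minValue_eq {E : Type*} {h : E → ℝ} {W : Set E} {v : E} (hv : v ∈ argminOn h W) :
    minValue h W = h v :=
  IsLeast.csInf_eq ⟨mem_image_of_mem h hv.1, forall_mem_image.2 hv.2⟩

variable {E : Type*} [NormedAddCommGroup E] {h : E → ℝ} {W : Set E}

theorem argminOn_nonempty (hW : IsCompact W) (hne : W.Nonempty) (hc : ContinuousOn h W) :
    (argminOn h W).Nonempty :=
  hW.exists_isMinOn hne hc

theorem isClosed_argminOn (hW : IsClosed W) (hc : ContinuousOn h W) :
    IsClosed (argminOn h W) := by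
  rcases (argminOn h W).eq_empty_or_nonempty with he | ⟨v, hv⟩
  · rw [he]; exact isClosed_empty
  · have hsublevel : argminOn h W = W ∩ h ⁻¹' Iic (h v) := by
      ext w
      exact ⟨fun hw => ⟨hw.1, hw.2 v hv.1⟩, fun hw => ⟨hw.1, fun u hu => le_trans hw.2 (hv.2 u hu)⟩⟩
    rw [hsublevel]
    exact hc.preimage_isClosed_of_isClosed hW isClosed_Iic

theorem exists_isNearest [ProperSpace E] {K : Set E} (hK : IsClosed K) (hne : K.Nonempty)
    (x : E) : ∃ y, IsNearest K x y := by
  obtain ⟨y, hy, hdist⟩ := hK.exists_infDist_eq_dist hne x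
  refine ⟨y, hy, fun u hu => ?_⟩
  rw [← dist_eq_norm, ← dist_eq_norm, ← hdist]
  exact Metric.infDist_le_dist_of_mem hu

theorem WeakSharpMinima.exists_ebc (hb : Bornology.IsBounded W) {κ : ℝ} (hκ : 0 < κ)
    (hs : WeakSharpMinima h W κ) : ∃ α > 0, EBC h W 1 α := by
  obtain ⟨D, hD, hdist⟩ := hb.exists_pos_norm_le
  refine ⟨2 * D * κ, by positivity, fun w hw => ?_⟩
  obtain ⟨v, hv, hle⟩ := hs w hw
  refine ⟨v, hv, ?_⟩
  have hdiam : ‖w - v‖ ≤ 2 * D :=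
    (norm_sub_le _ _).trans (by linarith [hdist w hw, hdist v hv.1.1])
  rw [Real.rpow_one, sq, mul_assoc]
  exact mul_le_mul hdiam hle (norm_nonneg _) (by positivity)

end Minimizers

section PiecewiseLinear

variable {E : Type*} [NormedAddCommGroup E] [InnerProductSpace ℝ E] {h : E → ℝ} {W : Set E}

theorem IsPiecewiseLinearOn.continuousOn (hW : IsClosed W) (hh : IsPiecewiseLinearOn h W) :
    ContinuousOn h W := by
  obtain ⟨N, Q, hQ, hcov, haff⟩ := hh
  rw [← inter_eq_left.2 hcov, inter_iUnion]
  refine (locallyFinite_of_finite _).continuousOn_iUnion (fun j => hW.inter (hQ j).isClosed)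
    fun j => ?_
  obtain ⟨a, b, hab⟩ := haff j
  exact ContinuousOn.congr (f := fun w => inner ℝ a w + b) (by fun_prop) hab

theorem IsPiecewiseLinearOn.exists_weakSharpMinima [FiniteDimensional ℝ E]
    (hW : IsPolyhedron W) (hb : Bornology.IsBounded W) (hne : W.Nonempty)
    (hh : IsPiecewiseLinearOn h W) : ∃ κ > 0, WeakSharpMinima h W κ := by
  have hcont := hh.continuousOn hW.isClosed
  obtain ⟨v₀, hv₀⟩ :=
    argminOn_nonempty (Metric.isCompact_of_isClosed_isBounded hW.isClosed hb) hne hcont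
  obtain ⟨N, Q, hQ, hcov, haff⟩ := hh
  have hpieces : ∀ᶠ κ in atTop, ∀ j, ∀ w ∈ W ∩ Q j, ∃ v ∈ argminOn h W,
      ‖w - v‖ ≤ κ * (h w - h v₀) := by
    refine eventually_all.2 fun j => ?_
    refine (hW.inter (hQ j)).eventually_sharp (hb.subset inter_subset_left) (haff j)
      (fun w hw => hv₀.2 w hw.1) ⟨v₀, hv₀⟩ fun v hv heq => ⟨hv.1, fun u hu => ?_⟩
    exact heq.trans_le (hv₀.2 u hu)
  obtain ⟨κ, hκ, hpos⟩ := (hpieces.and (eventually_gt_atTop 0)).exists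
  refine ⟨κ, hpos, fun w hw => ?_⟩
  obtain ⟨j, hj⟩ := mem_iUnion.1 (hcov hw)
  obtain ⟨v, hv, hle⟩ := hκ j w ⟨hw, hj⟩
  obtain ⟨y, hy⟩ := exists_isNearest (isClosed_argminOn hW.isClosed hcont) ⟨v₀, hv₀⟩ w
  refine ⟨y, hy, (hy.2 v hv).trans ?_⟩
  rwa [← minValue_eq hy.1, minValue_eq hv₀]

end PiecewiseLinear

section IidLaw

theorem preimage_update_pi {ι Z : Type*} [DecidableEq ι] (s : Finset ι) (A : ι → Set Z) (t : ι) :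
    (fun p : (ι → Z) × Z => Function.update p.1 t p.2) ⁻¹' Set.pi s A =
      Set.pi (s.erase t) A ×ˢ (if t ∈ s then A t else univ) := by
  ext ⟨z, x⟩
  simp only [mem_preimage, Set.mem_pi, mem_prod, Finset.mem_coe, Finset.mem_erase]
  constructor
  · intro h
    refine ⟨fun i hi => by simpa [hi.1] using h i hi.2, ?_⟩
    split_ifs with ht
    · simpa using h t ht
    · trivial
  · rintro ⟨h, hx⟩ i hi
    rcases eq_or_ne i t with rfl | hit
    · simpa [hi] using hx
    · simpa [hit] using h i ⟨hit, hi⟩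

theorem measure_biUnion_finset_le_ofReal {Ω ι : Type*} [MeasurableSpace Ω] {ν : Measure Ω}
    {s : Finset ι} {S : ι → Set Ω} {δ : ℝ} {m : ℕ} (hδ : 0 ≤ δ)
    (hcard : s.card ≤ m) (hS : ∀ i ∈ s, ν (S i) ≤ ENNReal.ofReal (δ / m)) :
    ν (⋃ i ∈ s, S i) ≤ ENNReal.ofReal δ := by
  calc ν (⋃ i ∈ s, S i) ≤ ∑ i ∈ s, ν (S i) := measure_biUnion_finset_le _ _
    _ ≤ s.card • ENNReal.ofReal (δ / m) := Finset.sum_le_card_nsmul _ _ _ hS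
    _ ≤ m • ENNReal.ofReal (δ / m) := by gcongr
    _ = ENNReal.ofReal (m * (δ / m)) := by
      rw [nsmul_eq_mul, ENNReal.ofReal_mul (Nat.cast_nonneg m), ENNReal.ofReal_natCast]
    _ ≤ ENNReal.ofReal δ := by
      refine ENNReal.ofReal_le_ofReal ?_
      rcases eq_or_ne (m : ℝ) 0 with hm | hm
      · simpa [hm] using hδ
      · rw [mul_div_cancel₀ δ hm]

variable {Z : Type*} [MeasurableSpace Z] (μ : Measure Z) [IsProbabilityMeasure μ]

instance : IsProbabilityMeasure (iidLaw μ) := by unfold iidLaw; infer_instance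

theorem ae_iidLaw_forall {p : Z → Prop} (hp : ∀ᵐ x ∂μ, p x) :
    ∀ᵐ z ∂(iidLaw μ), ∀ i, p (z i) :=
  ae_all_iff.2 fun i =>
    (measurePreserving_eval_infinitePi (fun _ : ℕ => μ) i).quasiMeasurePreserving.ae hp

theorem measurePreserving_update (t : ℕ) :
    MeasurePreserving (fun p : (ℕ → Z) × Z => Function.update p.1 t p.2)
      ((iidLaw μ).prod μ) (iidLaw μ) := by
  have hm : Measurable fun p : (ℕ → Z) × Z => Function.update p.1 t p.2 := by
    refine measurable_pi_lambda _ fun i => ?_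
    rcases eq_or_ne i t with rfl | hi
    · simpa using measurable_snd
    · simpa [hi, Function.comp_def] using (measurable_pi_apply i).comp measurable_fst
  refine ⟨hm, Measure.eq_infinitePi (fun _ => μ) fun s A hA => ?_⟩
  rw [Measure.map_apply hm (MeasurableSet.pi s.countable_toSet fun i _ => hA i),
    preimage_update_pi, Measure.prod_prod, iidLaw, Measure.infinitePi_pi _ fun i _ => hA i]
  split_ifs with ht
  · exact Finset.prod_erase_mul s (fun i => μ (A i)) ht
  · rw [measure_univ, mul_one, Finset.erase_eq_of_notMem ht]

theorem lintegral_iidLaw_fresh {t : ℕ} {F : (ℕ → Z) → Z → ENNReal}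
    (hF : Measurable (Function.uncurry F)) (hdep : DependsOn F {t}ᶜ) :
    ∫⁻ z, F z (z t) ∂(iidLaw μ) = ∫⁻ z, ∫⁻ x, F z x ∂μ ∂(iidLaw μ) := by
  have hdiag : Measurable fun z : ℕ → Z => F z (z t) :=
    hF.comp (measurable_id.prodMk (measurable_pi_apply t))
  have hupdate (z : ℕ → Z) (x : Z) : F (Function.update z t x) = F z :=
    hdep fun i hi => Function.update_of_ne hi _ _
  rw [← (measurePreserving_update μ t).lintegral_comp hdiag]
  simp only [Function.update_self, hupdate]
  exact lintegral_prod _ hF.aemeasurable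

theorem lintegral_iidLaw_prod_le (t₀ : ℕ) {ψ : ℕ → (ℕ → Z) → Z → ENNReal}
    (hψ : ∀ j, Measurable (Function.uncurry (ψ j))) (hdep : ∀ j, DependsOn (ψ j) (Iio (t₀ + j)))
    {a : ENNReal} (ha : ∀ j z, ∫⁻ x, ψ j z x ∂μ ≤ a) (T : ℕ) :
    ∫⁻ z, ∏ j ∈ Finset.range T, ψ j z (z (t₀ + j)) ∂(iidLaw μ) ≤ a ^ T := by
  induction T with
  | zero => simp
  | succ T ih =>
    have hprod : Measurable fun z : ℕ → Z => ∏ j ∈ Finset.range T, ψ j z (z (t₀ + j)) :=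
      Finset.measurable_fun_prod _ fun j _ =>
        (hψ j).comp (measurable_id.prodMk (measurable_pi_apply _))
    have hfresh := lintegral_iidLaw_fresh μ (t := t₀ + T)
      (F := fun z x => (∏ j ∈ Finset.range T, ψ j z (z (t₀ + j))) * ψ T z x)
      ((hprod.comp measurable_fst).mul (hψ T)) fun z z' h => by
        have hpast (j : ℕ) (hj : j ≤ T) : ψ j z = ψ j z' :=
          hdep j fun i hi => h i (by simp only [mem_Iio] at hi; simp; omega)
        funext x
        simp only [hpast T le_rfl]
        congr 1
        refine Finset.prod_congr rfl fun j hj => ?_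
        have hj := Finset.mem_range.1 hj
        rw [hpast j hj.le, h (t₀ + j) (by simp; omega)]
    simp only [Finset.prod_range_succ]
    calc _ = ∫⁻ z, (∏ j ∈ Finset.range T, ψ j z (z (t₀ + j))) * ∫⁻ x, ψ T z x ∂μ ∂(iidLaw μ) := by
          rw [hfresh]
          congr with z
          exact lintegral_const_mul _ ((hψ T).comp measurable_prodMk_left)
      _ ≤ ∫⁻ z, (∏ j ∈ Finset.range T, ψ j z (z (t₀ + j))) * a ∂(iidLaw μ) := by
          gcongr with z
          exact ha T z
      _ = (∫⁻ z, ∏ j ∈ Finset.range T, ψ j z (z (t₀ + j)) ∂(iidLaw μ)) * a :=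
          lintegral_mul_const _ hprod
      _ ≤ a ^ (T + 1) := by
          rw [pow_succ]
          gcongr

theorem iidLaw_sum_ge_le (t₀ : ℕ) {X : ℕ → (ℕ → Z) → Z → ℝ}
    (hX : ∀ j, Measurable (Function.uncurry (X j))) (hdep : ∀ j, DependsOn (X j) (Iio (t₀ + j)))
    {b : ℝ} (hb : ∀ j z, ∫⁻ x, ENNReal.ofReal (Real.exp (X j z x)) ∂μ ≤
      ENNReal.ofReal (Real.exp b)) (T : ℕ) (s : ℝ) :
    iidLaw μ {z | s ≤ ∑ j ∈ Finset.range T, X j z (z (t₀ + j))} ≤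
      ENNReal.ofReal (Real.exp (T * b - s)) := by
  have hexp (z : ℕ → Z) : ENNReal.ofReal (Real.exp (∑ j ∈ Finset.range T, X j z (z (t₀ + j)))) =
      ∏ j ∈ Finset.range T, ENNReal.ofReal (Real.exp (X j z (z (t₀ + j)))) := by
    rw [Real.exp_sum, ENNReal.ofReal_prod_of_nonneg fun _ _ => (Real.exp_pos _).le]
  have hmeas : Measurable fun z : ℕ → Z => ∑ j ∈ Finset.range T, X j z (z (t₀ + j)) :=
    Finset.measurable_fun_sum _ fun j _ =>
      (hX j).comp (measurable_id.prodMk (measurable_pi_apply _))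
  have hmgf := lintegral_iidLaw_prod_le μ t₀
    (ψ := fun j z x => ENNReal.ofReal (Real.exp (X j z x)))
    (fun j => (Real.measurable_exp.comp (hX j)).ennreal_ofReal)
    (fun j z z' h => by simp only [hdep j h]) hb T
  have hmarkov := mul_meas_ge_le_lintegral (μ := iidLaw μ)
    (Real.measurable_exp.comp hmeas).ennreal_ofReal (ENNReal.ofReal (Real.exp s))
  simp only [Function.comp_apply, hexp] at hmarkov
  rw [Real.exp_sub, ENNReal.ofReal_div_of_pos (Real.exp_pos s), Real.exp_nat_mul,
    ENNReal.ofReal_pow (Real.exp_pos b).le,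
    ENNReal.le_div_iff_mul_le (.inl (by simp [Real.exp_pos])) (.inl ENNReal.ofReal_ne_top),
    mul_comm]
  refine le_trans ?_ (hmarkov.trans hmgf)
  gcongr with z
  intro hs
  rw [← hexp]
  gcongr

theorem iidLaw_sum_apply_ge_le {X : Z → ℝ} (hX : AEMeasurable X μ) {b : ℝ}
    (hb : ∫⁻ x, ENNReal.ofReal (Real.exp (X x)) ∂μ ≤ ENNReal.ofReal (Real.exp b)) (T : ℕ) (s : ℝ) :
    iidLaw μ {z | s ≤ ∑ j ∈ Finset.range T, X (z j)} ≤
      ENNReal.ofReal (Real.exp (T * b - s)) := by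
  have h := iidLaw_sum_ge_le μ 0 (X := fun _ _ => hX.mk X)
    (fun _ => hX.measurable_mk.comp measurable_snd) (fun _ _ _ _ => rfl) (b := b)
    (fun _ _ => by
      refine le_of_eq_of_le (lintegral_congr_ae ?_) hb
      filter_upwards [hX.ae_eq_mk] with x hx using by rw [hx]) T s
  refine le_of_eq_of_le (measure_congr (eventuallyEq_set.2 ?_)) h
  filter_upwards [ae_iidLaw_forall μ hX.ae_eq_mk] with z hz
  simp [hz]

theorem lintegral_exp_mul_le_of_abs_le {X : Z → ℝ} (hX : AEMeasurable X μ) {c : ℝ}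
    (hc : ∀ x, |X x| ≤ c) (hzero : ∫ x, X x ∂μ = 0) (l : ℝ) :
    ∫⁻ x, ENNReal.ofReal (Real.exp (l * X x)) ∂μ ≤
      ENNReal.ofReal (Real.exp (c ^ 2 * l ^ 2 / 2)) := by
  have hsub := ProbabilityTheory.hasSubgaussianMGF_of_mem_Icc_of_integral_eq_zero hX
    (.of_forall fun x => abs_le.1 (hc x)) hzero
  rw [← ofReal_integral_eq_lintegral_ofReal (hsub.integrable_exp_mul l)
    (.of_forall fun x => (Real.exp_pos _).le)]
  refine ENNReal.ofReal_le_ofReal ((hsub.mgf_le l).trans_eq ?_)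
  have hparam : (((‖c - -c‖₊ / 2) ^ 2 : NNReal) : ℝ) = c ^ 2 := by
    push_cast
    rw [Real.norm_eq_abs, div_pow, sq_abs]
    ring
  rw [hparam]

theorem iidLaw_sum_ge_le_of_abs_le (t₀ : ℕ) {X : ℕ → (ℕ → Z) → Z → ℝ}
    (hX : ∀ j, Measurable (Function.uncurry (X j))) (hdep : ∀ j, DependsOn (X j) (Iio (t₀ + j)))
    {c : ℝ} (hc : ∀ j z x, |X j z x| ≤ c) (hzero : ∀ j z, ∫ x, X j z x ∂μ = 0) (T : ℕ) {s : ℝ}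
    (hs : 0 ≤ s) :
    iidLaw μ {z | s ≤ ∑ j ∈ Finset.range T, X j z (z (t₀ + j))} ≤
      ENNReal.ofReal (Real.exp (-(s ^ 2 / (2 * (T * c ^ 2))))) := by
  -- `l` maximizes `l * s - T * (c ^ 2 * l ^ 2 / 2)`; it is `0` if `T * c ^ 2 = 0`.
  set l : ℝ := s / (T * c ^ 2) with hl
  have hchernoff := iidLaw_sum_ge_le μ t₀ (X := fun j z x => l * X j z x)
    (fun j => (hX j).const_mul l) (fun j z z' h => by simp only [hdep j h])
    (fun j z => lintegral_exp_mul_le_of_abs_le μ ((hX j).comp measurable_prodMk_left).aemeasurable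
      (hc j z) (hzero j z) l) T (l * s)
  have hexponent : T * (c ^ 2 * l ^ 2 / 2) - l * s = -(s ^ 2 / (2 * (T * c ^ 2))) := by
    rcases eq_or_ne (T * c ^ 2 : ℝ) 0 with h0 | h0
    · simp [hl, h0]
    · calc T * (c ^ 2 * l ^ 2 / 2) - l * s = l * (T * c ^ 2 * l / 2 - s) := by ring
        _ = s / (T * c ^ 2) * (s / 2 - s) := by rw [hl, mul_div_cancel₀ _ h0]
        _ = _ := by ring
  rw [hexponent] at hchernoff
  refine (measure_mono fun z hz => ?_).trans hchernoff
  simp only [mem_ofPred_eq, ← Finset.mul_sum] at hz ⊢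
  gcongr

end IidLaw

section Net

variable {E : Type*} [NormedAddCommGroup E] [InnerProductSpace ℝ E]

theorem norm_sub_le_of_floor_eq {ι : Type*} [Fintype ι] (e : OrthonormalBasis ι ℝ E) {M : ℕ}
    (hM : 0 < M) {x y : E} (h : ∀ i, ⌊inner ℝ (e i) x * M⌋ = ⌊inner ℝ (e i) y * M⌋) :
    ‖x - y‖ ≤ √(Fintype.card ι) / M := by
  have hM : (0 : ℝ) < M := Nat.cast_pos.2 hM
  have hcoord (i : ι) : ‖inner ℝ (e i) (x - y)‖ ^ 2 ≤ (1 / M : ℝ) ^ 2 := by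
    have hlt := Int.abs_sub_lt_one_of_floor_eq_floor (h i)
    rw [← sub_mul, ← inner_sub_right, abs_mul, abs_of_pos hM] at hlt
    gcongr
    exact (le_div_iff₀ hM).2 hlt.le
  refine le_of_sq_le_sq ?_ (by positivity)
  calc ‖x - y‖ ^ 2 = ∑ i, ‖inner ℝ (e i) (x - y)‖ ^ 2 := (e.sum_sq_norm_inner_right _).symm
    _ ≤ ∑ _i : ι, (1 / M : ℝ) ^ 2 := Finset.sum_le_sum fun i _ => hcoord i
    _ = (√(Fintype.card ι) / M) ^ 2 := by
      rw [div_pow, div_pow, Real.sq_sqrt (Nat.cast_nonneg _)]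
      simp [div_eq_mul_inv]

theorem exists_finset_subset_forall_exists_eq {α β : Type*} {W : Set α} {c : α → β} {B : Finset β}
    (hc : MapsTo c W B) :
    ∃ A : Finset α, ↑A ⊆ W ∧ A.card ≤ B.card ∧ ∀ w ∈ W, ∃ u ∈ A, c w = c u := by
  obtain ⟨A, hAW, hbij⟩ := exists_subset_bijOn W c
  have hAB : MapsTo c A B := hc.mono_left hAW
  have hfin : A.Finite := .of_injOn hAB hbij.injOn B.finite_toSet
  refine ⟨hfin.toFinset, by simpa using hAW, Finset.card_le_card_of_injOn c ?_ ?_, fun w hw => ?_⟩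
  · simpa using hAB
  · simpa using hbij.injOn
  · obtain ⟨u, hu, heq⟩ := hbij.surjOn (mem_image_of_mem c hw)
    exact ⟨u, by simpa using hu, heq.symm⟩

variable [FiniteDimensional ℝ E] {W : Set E} {R : ℝ}

open Module in
theorem exists_grid_net (hR : ∀ w ∈ W, ‖w‖ ≤ R) {M : ℕ} (hM : 0 < M) :
    ∃ A : Finset E, ↑A ⊆ W ∧ (A.card : ℝ) ≤ (2 * (|R| * M) + 2) ^ finrank ℝ E ∧
      ∀ w ∈ W, ∃ u ∈ A, ‖w - u‖ ≤ √(finrank ℝ E) / M := by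
  set e := stdOrthonormalBasis ℝ E
  set B : Finset (Fin (finrank ℝ E) → ℤ) :=
    Fintype.piFinset fun _ => Finset.Icc ⌊-(|R| * M)⌋ ⌊|R| * M⌋ with hB
  have hcell : MapsTo (fun w i => ⌊inner ℝ (e i) w * M⌋) W B := by
    intro w hw
    simp only [hB, Finset.mem_coe, Fintype.mem_piFinset, Finset.mem_Icc]
    intro i
    have hcoord : |inner ℝ (e i) w| ≤ |R| := by
      simpa using (abs_real_inner_le_norm (e i) w).trans
        ((mul_le_mul_of_nonneg_left (hR w hw) (norm_nonneg _)).trans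
          (by simpa using le_abs_self R))
    obtain ⟨hlo, hhi⟩ := abs_le.1 hcoord
    exact ⟨by rw [← neg_mul]; gcongr, by gcongr⟩
  obtain ⟨A, hAW, hcard, hnet⟩ := exists_finset_subset_forall_exists_eq hcell
  refine ⟨A, hAW, ?_, fun w hw => ?_⟩
  · have hside : ((⌊|R| * M⌋ + 1 - ⌊-(|R| * M)⌋).toNat : ℝ) ≤ 2 * (|R| * M) + 2 := by
      rw [← Int.cast_natCast, Int.toNat_eq_max, Int.cast_max]
      push_cast
      refine max_le ?_ (by positivity)
      linarith [Int.floor_le (|R| * M), Int.lt_floor_add_one (-(|R| * M))]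
    calc (A.card : ℝ) ≤ B.card := by exact_mod_cast hcard
      _ = ((⌊|R| * M⌋ + 1 - ⌊-(|R| * M)⌋).toNat : ℝ) ^ finrank ℝ E := by
        simp [hB, Fintype.card_piFinset]
      _ ≤ _ := by gcongr
  · obtain ⟨u, hu, heq⟩ := hnet w hw
    refine ⟨u, hu, ?_⟩
    simpa using norm_sub_le_of_floor_eq e hM fun i => congrFun heq i

/-- The factor in front of `d log n` in a bound for the logarithm of the size of a `d / n ^ 2`-net
of a set of radius `R`: a grid of mesh `1 / n ^ 2` has at most `((2 |R| + 2) n ^ 2) ^ d` cells. -/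
def entropyConst (R : ℝ) : ℝ := 2 + Real.log (2 * |R| + 2) / Real.log 2

theorem one_le_entropyConst (R : ℝ) : 1 ≤ entropyConst R := by
  have hlog : 0 ≤ Real.log (2 * |R| + 2) := Real.log_nonneg (by linarith [abs_nonneg R])
  have := div_nonneg hlog (Real.log_nonneg one_le_two)
  unfold entropyConst
  linarith

open Module in
theorem exists_net_card_le (hR : ∀ w ∈ W, ‖w‖ ≤ R) {n : ℕ} (hn : 2 ≤ n) :
    ∃ A : Finset E, ↑A ⊆ W ∧
      (A.card : ℝ) ≤ Real.exp (entropyConst R * (finrank ℝ E * Real.log n)) ∧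
      ∀ w ∈ W, ∃ u ∈ A, ‖w - u‖ ≤ finrank ℝ E / (n : ℝ) ^ 2 := by
  obtain ⟨A, hAW, hcard, hnet⟩ := exists_grid_net hR (M := n ^ 2) (by positivity)
  have hn : (2 : ℝ) ≤ n := by exact_mod_cast hn
  have hlog2 : 0 < Real.log 2 := Real.log_pos one_lt_two
  have hside : Real.log (2 * (|R| * (n ^ 2 : ℕ)) + 2) ≤ entropyConst R * Real.log n := by
    have hlog : 0 ≤ Real.log (2 * |R| + 2) := Real.log_nonneg (by linarith [abs_nonneg R])
    calc Real.log (2 * (|R| * (n ^ 2 : ℕ)) + 2) ≤ Real.log ((2 * |R| + 2) * n ^ 2) := by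
          gcongr
          push_cast
          nlinarith
      _ = 2 * Real.log n + Real.log (2 * |R| + 2) / Real.log 2 * Real.log 2 := by
          rw [Real.log_mul (by positivity) (by positivity), Real.log_pow,
            div_mul_cancel₀ _ hlog2.ne']
          push_cast
          ring
      _ ≤ 2 * Real.log n + Real.log (2 * |R| + 2) / Real.log 2 * Real.log n := by gcongr
      _ = entropyConst R * Real.log n := by rw [entropyConst]; ring
  refine ⟨A, hAW, hcard.trans ?_, fun w hw => ?_⟩
  · rw [← Real.exp_log (x := 2 * (|R| * (n ^ 2 : ℕ)) + 2) (by positivity), ← Real.exp_nat_mul]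
    refine Real.exp_le_exp.2 ?_
    linarith [mul_le_mul_of_nonneg_left hside (Nat.cast_nonneg (finrank ℝ E))]
  · obtain ⟨u, hu, hle⟩ := hnet w hw
    refine ⟨u, hu, hle.trans ?_⟩
    push_cast
    gcongr
    rw [Real.sqrt_le_left (by positivity)]
    exact_mod_cast Nat.le_self_pow two_ne_zero _

end Net

section EmpiricalRisk

variable {E Z : Type*} [NormedAddCommGroup E] {f : E → Z → ℝ} {W : Set E} {G : ℝ}

theorem sum_loss_sub_le_of_mem_argminOn_empRisk (hG : IsLipschitzLoss f W G) {n : ℕ} {z : ℕ → Z}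
    {w u v : E} (hw : w ∈ argminOn (empRisk f n z) W) (hu : u ∈ W) (hv : v ∈ W) :
    ∑ j ∈ Finset.range n, (f u (z j) - f v (z j)) ≤ n * (G * ‖w - u‖) := by
  rcases n.eq_zero_or_pos with rfl | hn
  · simp
  have hmin : ∑ j ∈ Finset.range n, f w (z j) ≤ ∑ j ∈ Finset.range n, f v (z j) :=
    le_of_mul_le_mul_left (hw.2 v hv) (by positivity)
  calc ∑ j ∈ Finset.range n, (f u (z j) - f v (z j))
      = ∑ j ∈ Finset.range n, f u (z j) - ∑ j ∈ Finset.range n, f v (z j) :=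
        Finset.sum_sub_distrib _ _
    _ ≤ ∑ j ∈ Finset.range n, f u (z j) - ∑ j ∈ Finset.range n, f w (z j) := by gcongr
    _ = ∑ j ∈ Finset.range n, (f u (z j) - f w (z j)) := (Finset.sum_sub_distrib _ _).symm
    _ ≤ ∑ _j ∈ Finset.range n, G * ‖w - u‖ := Finset.sum_le_sum fun j _ =>
        (neg_le_abs _).trans' (neg_sub (f w (z j)) _).ge |>.trans (hG (z j) w hw.1 u hu)
    _ = n * (G * ‖w - u‖) := by simp

variable [MeasurableSpace Z] {μ : Measure Z} [IsProbabilityMeasure μ]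

theorem risk_sub_le (hf : ∀ w ∈ W, Integrable (f w) μ) (hG : IsLipschitzLoss f W G) {w u : E}
    (hw : w ∈ W) (hu : u ∈ W) : risk μ f w - risk μ f u ≤ G * ‖w - u‖ := by
  unfold risk
  rw [← integral_sub (hf w hw) (hf u hu)]
  calc ∫ z, (f w z - f u z) ∂μ ≤ ∫ _, G * ‖w - u‖ ∂μ :=
        integral_mono ((hf w hw).sub (hf u hu)) (integrable_const _) fun z =>
          (le_abs_self _).trans (hG z w hw u hu)
    _ = G * ‖w - u‖ := by simp

theorem continuousOn_risk (hf : ∀ w ∈ W, Integrable (f w) μ) (hG : IsLipschitzLoss f W G) :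
    ContinuousOn (risk μ f) W :=
  (LipschitzOnWith.of_le_add_mul' G fun w hw u hu => by
    rw [dist_eq_norm]
    linarith [risk_sub_le hf hG hw hu]).continuousOn

theorem lintegral_exp_neg_le {X : Z → ℝ} (hX : Integrable X μ) {c : ℝ} (hc1 : c ≤ 1)
    (hc : ∀ x, |X x| ≤ c) :
    ∫⁻ x, ENNReal.ofReal (Real.exp (-X x)) ∂μ ≤
      ENNReal.ofReal (Real.exp (-∫ x, X x ∂μ + c ^ 2)) := by
  have hpt (x : Z) : Real.exp (-X x) ≤ 1 - X x + c ^ 2 := by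
    have habs : |-X x| ≤ c := (abs_neg (X x)).trans_le (hc x)
    have htaylor := (abs_le.1 (Real.abs_exp_sub_one_sub_id_le (habs.trans hc1))).2
    linarith [sq_le_sq' (neg_le_of_abs_le habs) (le_of_abs_le habs)]
  have hint : Integrable (fun x => 1 - X x + c ^ 2) μ :=
    ((integrable_const 1).sub hX).add (integrable_const _)
  calc ∫⁻ x, ENNReal.ofReal (Real.exp (-X x)) ∂μ
      ≤ ∫⁻ x, ENNReal.ofReal (1 - X x + c ^ 2) ∂μ :=
        lintegral_mono fun x => ENNReal.ofReal_le_ofReal (hpt x)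
    _ = ENNReal.ofReal (∫ x, (1 - X x + c ^ 2) ∂μ) :=
        (ofReal_integral_eq_lintegral_ofReal hint
          (.of_forall fun x => (Real.exp_pos _).le.trans (hpt x))).symm
    _ ≤ ENNReal.ofReal (Real.exp (-∫ x, X x ∂μ + c ^ 2)) := by
        refine ENNReal.ofReal_le_ofReal ?_
        rw [integral_add (f := fun x => 1 - X x) ((integrable_const 1).sub hX)
          (integrable_const _), integral_sub (integrable_const 1) hX]
        simp only [integral_const, probReal_univ, one_smul]
        linarith [Real.add_one_le_exp (-∫ x, X x ∂μ + c ^ 2)]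

theorem lintegral_exp_loss_sub_le (hf : ∀ w ∈ W, Integrable (f w) μ)
    (hG : IsLipschitzLoss f W G) {u v : E} (hu : u ∈ W) (hv : v ∈ W) {l : ℝ} (hl : 0 ≤ l)
    (hone : l * (G * ‖u - v‖) ≤ 1)
    (hsq : (l * (G * ‖u - v‖)) ^ 2 ≤ l * (risk μ f u - risk μ f v) / 2) :
    ∫⁻ z, ENNReal.ofReal (Real.exp (-(l * (f u z - f v z)))) ∂μ ≤
      ENNReal.ofReal (Real.exp (-(l * (risk μ f u - risk μ f v) / 2))) := by
  have hint : Integrable (fun z => l * (f u z - f v z)) μ :=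
    ((hf u hu).sub (hf v hv)).const_mul l
  refine (lintegral_exp_neg_le hint hone fun z => ?_).trans
    (ENNReal.ofReal_le_ofReal (Real.exp_le_exp.2 ?_))
  · rw [abs_mul, abs_of_nonneg hl]
    exact mul_le_mul_of_nonneg_left (hG z u hu v hv) hl
  · rw [integral_const_mul, integral_sub (hf u hu) (hf v hv)]
    unfold risk at hsq ⊢
    linarith

theorem iidLaw_sum_loss_sub_le (hf : ∀ w ∈ W, Integrable (f w) μ)
    (hG : IsLipschitzLoss f W G) {u v : E} (hu : u ∈ W) (hv : v ∈ W) {l : ℝ} (hl : 0 ≤ l)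
    (hone : l * (G * ‖u - v‖) ≤ 1)
    (hsq : (l * (G * ‖u - v‖)) ^ 2 ≤ l * (risk μ f u - risk μ f v) / 2) {η : ℝ}
    (hη : 4 * η ≤ risk μ f u - risk μ f v) (n : ℕ) :
    iidLaw μ {z | ∑ j ∈ Finset.range n, (f u (z j) - f v (z j)) ≤ n * η} ≤
      ENNReal.ofReal (Real.exp (-(n * (l * (risk μ f u - risk μ f v)) / 4))) := by
  have hmeas : AEMeasurable (fun x => -(l * (f u x - f v x))) μ :=
    (((hf u hu).aemeasurable.sub (hf v hv).aemeasurable).const_mul l).neg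
  have hchernoff := iidLaw_sum_apply_ge_le μ hmeas
    (lintegral_exp_loss_sub_le hf hG hu hv hl hone hsq) n (-(l * (n * η)))
  refine (measure_mono fun z hz => ?_).trans (hchernoff.trans ?_)
  · simp only [mem_ofPred_eq, Finset.sum_neg_distrib, ← Finset.mul_sum, neg_le_neg_iff] at hz ⊢
    gcongr
  · gcongr
    linarith [mul_le_mul_of_nonneg_left hη (mul_nonneg (Nat.cast_nonneg n) hl)]

theorem iidLaw_erm_le_of_net (hf : ∀ w ∈ W, Integrable (f w) μ) (hG0 : 0 ≤ G)
    (hG : IsLipschitzLoss f W G) {A : Finset E} (hAW : ↑A ⊆ W) {ε : ℝ}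
    (hnet : ∀ w ∈ W, ∃ u ∈ A, ‖w - u‖ ≤ ε) {n : ℕ} {δ : ℝ} (hδ : 0 < δ) {p τ : ℝ}
    (hετ : 4 * (G * ε) ≤ τ)
    (hlocal : ∀ u ∈ A, τ < risk μ f u - p → ∃ v ∈ W, risk μ f v = p ∧ ∃ l ≥ 0,
      l * (G * ‖u - v‖) ≤ 1 ∧ (l * (G * ‖u - v‖)) ^ 2 ≤ l * (risk μ f u - p) / 2 ∧
      Real.log (A.card / δ) ≤ n * (l * (risk μ f u - p)) / 4) :
    iidLaw μ {z | ∃ w ∈ argminOn (empRisk f n z) W, τ + G * ε < risk μ f w - p} ≤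
      ENNReal.ofReal δ := by
  classical
  choose! v hv hvp l hl hone hsq hlog using hlocal
  have hsub : {z | ∃ w ∈ argminOn (empRisk f n z) W, τ + G * ε < risk μ f w - p} ⊆
      ⋃ u ∈ {u ∈ A | τ < risk μ f u - p},
        {z | ∑ j ∈ Finset.range n, (f u (z j) - f (v u) (z j)) ≤ n * (G * ε)} := by
    rintro z ⟨w, hw, hlt⟩
    obtain ⟨u, hu, hwu⟩ := hnet w hw.1
    have hGε : G * ‖w - u‖ ≤ G * ε := mul_le_mul_of_nonneg_left hwu hG0
    have hτ : τ < risk μ f u - p := by linarith [risk_sub_le hf hG hw.1 (hAW hu)]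
    refine mem_biUnion (Finset.mem_filter.2 ⟨hu, hτ⟩) ?_
    exact (sum_loss_sub_le_of_mem_argminOn_empRisk hG hw (hAW hu) (hv u hu hτ)).trans (by gcongr)
  refine (measure_mono hsub).trans
    (measure_biUnion_finset_le_ofReal hδ.le (Finset.card_filter_le _ _) fun u hu => ?_)
  obtain ⟨hu, hτ⟩ := Finset.mem_filter.1 hu
  have hcard : (0 : ℝ) < A.card := Nat.cast_pos.2 (Finset.card_pos.2 ⟨u, hu⟩)
  have htail := iidLaw_sum_loss_sub_le hf hG (hAW hu) (hv u hu hτ) (hl u hu hτ) (hone u hu hτ)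
    (by rw [hvp u hu hτ]; exact hsq u hu hτ) (η := G * ε) (by rw [hvp u hu hτ]; linarith) n
  rw [hvp u hu hτ] at htail
  refine htail.trans (ENNReal.ofReal_le_ofReal ?_)
  rw [← Real.le_log_iff_exp_le (by positivity), ← inv_div (A.card : ℝ) δ, Real.log_inv]
  exact neg_le_neg (hlog u hu hτ)

end EmpiricalRisk

section ErmRates

/-- The complexity term `d log n + log (1 / δ)` in the rates of empirical risk minimization over a
set of dimension `d` with `n` samples and failure probability `δ`. -/
def ermComplexity (d n : ℕ) (δ : ℝ) : ℝ := d * Real.log n + Real.log (1 / δ)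

theorem ermComplexity_nonneg (d n : ℕ) {δ : ℝ} (hδ : 0 < δ) (hδ1 : δ ≤ 1) :
    0 ≤ ermComplexity d n δ :=
  add_nonneg (mul_nonneg d.cast_nonneg (Real.log_natCast_nonneg n))
    (Real.log_nonneg (one_le_one_div hδ hδ1))

theorem half_le_log_of_two_le {n : ℕ} (hn : 2 ≤ n) : 1 / 2 ≤ Real.log n :=
  calc (1 / 2 : ℝ) ≤ Real.log 2 := by linarith [Real.log_two_gt_d9]
    _ ≤ Real.log n := Real.log_le_log two_pos (by exact_mod_cast hn)

theorem cast_le_two_mul_ermComplexity (d : ℕ) {n : ℕ} (hn : 2 ≤ n) {δ : ℝ} (hδ : 0 < δ)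
    (hδ1 : δ ≤ 1) : (d : ℝ) ≤ 2 * ermComplexity d n δ := by
  have hlogδ : 0 ≤ Real.log (1 / δ) := Real.log_nonneg (one_le_one_div hδ hδ1)
  have hlogn := mul_le_mul_of_nonneg_left (half_le_log_of_two_le hn) (Nat.cast_nonneg (α := ℝ) d)
  unfold ermComplexity
  linarith

theorem cast_div_sq_le_ermComplexity_div (d : ℕ) {n : ℕ} (hn : 2 ≤ n) {δ : ℝ} (hδ : 0 < δ)
    (hδ1 : δ ≤ 1) : (d : ℝ) / (n : ℝ) ^ 2 ≤ ermComplexity d n δ / n := by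
  have hn0 : (2 : ℝ) ≤ n := by exact_mod_cast hn
  have hd := cast_le_two_mul_ermComplexity d hn hδ hδ1
  have hL0 := ermComplexity_nonneg d n hδ hδ1
  rw [div_le_div_iff₀ (by positivity) (by positivity)]
  nlinarith [mul_nonneg hL0 (Nat.cast_nonneg (α := ℝ) n)]

theorem cast_div_sq_le_sq_ermComplexity_div (d : ℕ) {n : ℕ} (hn : 2 ≤ n) {δ : ℝ} (hδ : 0 < δ)
    (hδ1 : δ ≤ 1) : (d : ℝ) / (n : ℝ) ^ 2 ≤ 4 * (ermComplexity d n δ / n) ^ 2 := by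
  have hd := cast_le_two_mul_ermComplexity d hn hδ hδ1
  calc (d : ℝ) / (n : ℝ) ^ 2 ≤ (d : ℝ) ^ 2 / (n : ℝ) ^ 2 := by
        gcongr
        exact_mod_cast Nat.le_self_pow two_ne_zero _
    _ ≤ (2 * ermComplexity d n δ) ^ 2 / (n : ℝ) ^ 2 := by gcongr
    _ = 4 * (ermComplexity d n δ / n) ^ 2 := by ring

theorem log_div_le_mul_ermComplexity {d n : ℕ} {δ : ℝ} (hδ : 0 < δ) (hδ1 : δ ≤ 1) {K c : ℝ}
    (hK : 1 ≤ K) (hc : 0 < c) (hcK : c ≤ Real.exp (K * (d * Real.log n))) :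
    Real.log (c / δ) ≤ K * ermComplexity d n δ := by
  have hlogδ : 0 ≤ Real.log (1 / δ) := Real.log_nonneg (one_le_one_div hδ hδ1)
  calc Real.log (c / δ) = Real.log c + Real.log (1 / δ) := by
        rw [← Real.log_mul hc.ne' (by positivity), mul_one_div]
    _ ≤ K * (d * Real.log n) + K * Real.log (1 / δ) :=
        add_le_add ((Real.log_le_iff_le_exp hc).2 hcK) (le_mul_of_one_le_left hlogδ hK)
    _ = K * ermComplexity d n δ := (mul_add _ _ _).symm

variable {E Z : Type*} [NormedAddCommGroup E] [InnerProductSpace ℝ E] [FiniteDimensional ℝ E]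
  [MeasurableSpace Z] {μ : Measure Z} [IsProbabilityMeasure μ] {f : E → Z → ℝ} {W : Set E}
  {G R δ : ℝ} {n : ℕ}

open Module in
theorem iidLaw_erm_le (hf : ∀ w ∈ W, Integrable (f w) μ) (hG0 : 0 ≤ G)
    (hG : IsLipschitzLoss f W G) (hR : ∀ w ∈ W, ‖w‖ ≤ R) (hn : 2 ≤ n) (hδ : 0 < δ) (hδ1 : δ ≤ 1)
    {p τ : ℝ} (hτ : 4 * (G * (finrank ℝ E / (n : ℝ) ^ 2)) ≤ τ)
    (hlocal : ∀ u ∈ W, τ < risk μ f u - p → ∃ v ∈ W, risk μ f v = p ∧ ∃ l ≥ 0,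
      l * (G * ‖u - v‖) ≤ 1 ∧ (l * (G * ‖u - v‖)) ^ 2 ≤ l * (risk μ f u - p) / 2 ∧
      4 * (entropyConst R * ermComplexity (finrank ℝ E) n δ) ≤ n * (l * (risk μ f u - p))) :
    iidLaw μ {z | ∃ w ∈ argminOn (empRisk f n z) W,
      τ + G * (finrank ℝ E / (n : ℝ) ^ 2) < risk μ f w - p} ≤ ENNReal.ofReal δ := by
  obtain ⟨A, hAW, hcard, hnet⟩ := exists_net_card_le hR hn
  refine iidLaw_erm_le_of_net hf hG0 hG hAW hnet hδ hτ fun u hu hlt => ?_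
  obtain ⟨v, hv, hvp, l, hl, hone, hsq, hlog⟩ := hlocal u (hAW hu) hlt
  refine ⟨v, hv, hvp, l, hl, hone, hsq, ?_⟩
  have hpos : (0 : ℝ) < A.card := Nat.cast_pos.2 (Finset.card_pos.2 ⟨u, hu⟩)
  linarith [log_div_le_mul_ermComplexity hδ hδ1 (one_le_entropyConst R) hpos hcard]

theorem chernoff_parameter_of_sq_le {α B D e ρ : ℝ} (hα : 0 ≤ α) (hG : 0 ≤ G) (hD : 0 ≤ D)
    (hρ : 0 ≤ ρ) (hB : B = 2 * G ^ 2 * α + 2 * G * ρ) (hB0 : 0 < B) (heρ : e ≤ 2 * ρ)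
    (heD : e ^ 2 ≤ α * D) :
    1 / B * (G * e) ≤ 1 ∧ (1 / B * (G * e)) ^ 2 ≤ 1 / B * D / 2 := by
  constructor
  · rw [one_div_mul_eq_div, div_le_one hB0]
    have := mul_le_mul_of_nonneg_left heρ hG
    have : 0 ≤ 2 * G ^ 2 * α := by positivity
    linarith
  · calc (1 / B * (G * e)) ^ 2 = G ^ 2 * e ^ 2 / B ^ 2 := by field_simp
      _ ≤ B / 2 * D / B ^ 2 := by
          refine div_le_div_of_nonneg_right ?_ (sq_nonneg B)
          have := mul_le_mul_of_nonneg_left heD (sq_nonneg G)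
          have : 0 ≤ 2 * G * ρ * D := by positivity
          rw [hB]
          linarith
      _ = 1 / B * D / 2 := by field_simp

theorem chernoff_parameter_of_le_mul {κ D e : ℝ} (hG : 0 < G) (hκ : 0 < κ) (hD : 0 < D)
    (he : 0 ≤ e) (hDe : D ≤ G * e) (heD : e ≤ κ * D) :
    1 / (2 * G ^ 2 * κ ^ 2 * D) * (G * e) ≤ 1 ∧
      (1 / (2 * G ^ 2 * κ ^ 2 * D) * (G * e)) ^ 2 ≤ 1 / (2 * G ^ 2 * κ ^ 2 * D) * D / 2 := by
  have hGκ : G * e ≤ G * κ * D := by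
    rw [mul_assoc]
    exact mul_le_mul_of_nonneg_left heD hG.le
  constructor
  · have hone : 1 ≤ G * κ := le_of_mul_le_mul_right (by linarith) hD
    rw [one_div_mul_eq_div, div_le_one (by positivity)]
    calc G * e ≤ G * κ * D := hGκ
      _ ≤ 2 * (G * κ) * (G * κ * D) := le_mul_of_one_le_left (by positivity) (by linarith)
      _ = 2 * G ^ 2 * κ ^ 2 * D := by ring
  · calc (1 / (2 * G ^ 2 * κ ^ 2 * D) * (G * e)) ^ 2
        ≤ (1 / (2 * G ^ 2 * κ ^ 2 * D) * (G * κ * D)) ^ 2 := by gcongr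
      _ = 1 / (2 * G ^ 2 * κ ^ 2 * D) * D / 2 := by field_simp

/-- The constant in the rate of empirical risk minimization under the error bound condition with
exponent one. -/
def ermConst (α G R : ℝ) : ℝ :=
  5 * G + 4 * (entropyConst R * (2 * G ^ 2 * α + 2 * G * |R|))

open Module in
theorem iidLaw_erm_ebc_le (hf : ∀ w ∈ W, Integrable (f w) μ) (hG0 : 0 < G)
    (hG : IsLipschitzLoss f W G) {α : ℝ} (hα : 0 < α) (hebc : EBC (risk μ f) W 1 α)
    (hR : ∀ w ∈ W, ‖w‖ ≤ R) (hn : 2 ≤ n) (hδ : 0 < δ) (hδ1 : δ ≤ 1) :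
    iidLaw μ {z | ∃ w ∈ argminOn (empRisk f n z) W,
      ermConst α G R * (ermComplexity (finrank ℝ E) n δ / n) <
        risk μ f w - minValue (risk μ f) W} ≤ ENNReal.ofReal δ := by
  set L := ermComplexity (finrank ℝ E) n δ
  set K := entropyConst R
  set B := 2 * G ^ 2 * α + 2 * G * |R| with hB
  have hB0 : 0 < B := by positivity
  have hK0 : 0 < K := one_pos.trans_le (one_le_entropyConst R)
  have hL0 : 0 ≤ L := ermComplexity_nonneg _ n hδ hδ1
  have hε : G * (finrank ℝ E / (n : ℝ) ^ 2) ≤ G * (L / n) :=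
    mul_le_mul_of_nonneg_left (cast_div_sq_le_ermComplexity_div _ hn hδ hδ1) hG0.le
  have hconst : ermConst α G R * (L / n) = (4 * (K * B) + 4 * G) * (L / n) + G * (L / n) := by
    rw [ermConst]
    ring
  have hKB : 0 ≤ K * B * (L / n) := by positivity
  refine (measure_mono ?_).trans (iidLaw_erm_le (p := minValue (risk μ f) W)
    (τ := (4 * (K * B) + 4 * G) * (L / n)) hf hG0.le hG hR hn hδ hδ1 (by linarith) ?_)
  · rintro z ⟨w, hw, hlt⟩
    exact ⟨w, hw, by linarith⟩
  intro u hu hτ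
  obtain ⟨v, hv, hle⟩ := hebc u hu
  rw [Real.rpow_one, ← minValue_eq hv.1] at hle
  have huv : ‖u - v‖ ≤ 2 * |R| := by
    linarith [norm_sub_le u v, (hR u hu).trans (le_abs_self R), (hR v hv.1.1).trans (le_abs_self R)]
  have hD : 0 ≤ risk μ f u - minValue (risk μ f) W := le_trans (by positivity) hτ.le
  obtain ⟨hone, hsq⟩ := chernoff_parameter_of_sq_le hα.le hG0.le hD (abs_nonneg R) hB hB0 huv hle
  refine ⟨v, hv.1.1, (minValue_eq hv.1).symm, 1 / B, by positivity, hone, hsq, ?_⟩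
  have hGL : 0 ≤ 4 * G * (L / n) := by positivity
  calc 4 * (K * L) = n * (1 / B * (4 * (K * B) * (L / n))) := by field_simp
    _ ≤ n * (1 / B * (risk μ f u - minValue (risk μ f) W)) := by
        gcongr
        linarith

/-- The constant in the rate of empirical risk minimization under weak sharp minima. -/
def sharpConst (κ G R : ℝ) : ℝ :=
  20 * G + 2 * |R| * G * (8 * G ^ 2 * κ ^ 2 * entropyConst R) ^ 2

theorem sharpConst_nonneg (κ R : ℝ) (hG : 0 ≤ G) : 0 ≤ sharpConst κ G R := by
  unfold sharpConst
  positivity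

open Module in
theorem iidLaw_erm_sharp_le_of_le (hf : ∀ w ∈ W, Integrable (f w) μ) (hG0 : 0 < G)
    (hG : IsLipschitzLoss f W G) {κ : ℝ} (hκ : 0 < κ) (hs : WeakSharpMinima (risk μ f) W κ)
    (hR : ∀ w ∈ W, ‖w‖ ≤ R) (hn : 2 ≤ n) (hδ : 0 < δ) (hδ1 : δ ≤ 1)
    (hnL : 8 * G ^ 2 * κ ^ 2 * entropyConst R * ermComplexity (finrank ℝ E) n δ ≤ n) :
    iidLaw μ {z | ∃ w ∈ argminOn (empRisk f n z) W,
      20 * G * (ermComplexity (finrank ℝ E) n δ / n) ^ 2 <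
        risk μ f w - minValue (risk μ f) W} ≤ ENNReal.ofReal δ := by
  set L := ermComplexity (finrank ℝ E) n δ
  have hε : G * (finrank ℝ E / (n : ℝ) ^ 2) ≤ G * (4 * (L / n) ^ 2) :=
    mul_le_mul_of_nonneg_left (cast_div_sq_le_sq_ermComplexity_div _ hn hδ hδ1) hG0.le
  refine (measure_mono ?_).trans (iidLaw_erm_le (p := minValue (risk μ f) W)
    (τ := 16 * (G * (L / n) ^ 2)) hf hG0.le hG hR hn hδ hδ1 (by linarith) ?_)
  · rintro z ⟨w, hw, hlt⟩
    exact ⟨w, hw, by linarith⟩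
  intro u hu hτ
  obtain ⟨v, hv, hle⟩ := hs u hu
  have hD : 0 < risk μ f u - risk μ f v := by
    rw [← minValue_eq hv.1]
    exact lt_of_le_of_lt (by positivity) hτ
  have hLip : risk μ f u - risk μ f v ≤ G * ‖u - v‖ := risk_sub_le hf hG hu hv.1.1
  rw [minValue_eq hv.1]
  set D := risk μ f u - risk μ f v
  obtain ⟨hone, hsq⟩ := chernoff_parameter_of_le_mul hG0 hκ hD (norm_nonneg _) hLip hle
  refine ⟨v, hv.1.1, rfl, 1 / (2 * G ^ 2 * κ ^ 2 * D), by positivity, hone, hsq, ?_⟩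
  have hscale : n * (1 / (2 * G ^ 2 * κ ^ 2 * D) * D) = n / (2 * G ^ 2 * κ ^ 2) := by field_simp
  rw [hscale, le_div_iff₀ (by positivity)]
  linarith

open Module in
theorem iidLaw_erm_sharp_le (hf : ∀ w ∈ W, Integrable (f w) μ) (hG0 : 0 < G)
    (hG : IsLipschitzLoss f W G) {κ : ℝ} (hκ : 0 < κ) (hs : WeakSharpMinima (risk μ f) W κ)
    (hR : ∀ w ∈ W, ‖w‖ ≤ R) (hn : 2 ≤ n) (hδ : 0 < δ) (hδ1 : δ ≤ 1) :
    iidLaw μ {z | ∃ w ∈ argminOn (empRisk f n z) W,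
      sharpConst κ G R * (ermComplexity (finrank ℝ E) n δ / n) ^ 2 <
        risk μ f w - minValue (risk μ f) W} ≤ ENNReal.ofReal δ := by
  have hn0 : (0 : ℝ) < n := by positivity
  have hK0 : 0 < entropyConst R := one_pos.trans_le (one_le_entropyConst R)
  rcases le_or_gt (8 * G ^ 2 * κ ^ 2 * entropyConst R * ermComplexity (finrank ℝ E) n δ)
    (n : ℝ) with hnL | hnL
  · refine (measure_mono ?_).trans (iidLaw_erm_sharp_le_of_le hf hG0 hG hκ hs hR hn hδ hδ1 hnL)
    rintro z ⟨w, hw, hlt⟩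
    refine ⟨w, hw, hlt.trans_le' (mul_le_mul_of_nonneg_right ?_ (sq_nonneg _))⟩
    exact le_add_of_nonneg_right (by positivity)
  · refine (measure_mono_null ?_ measure_empty).le.trans zero_le
    rintro z ⟨w, hw, hlt⟩
    obtain ⟨v, hv, -⟩ := hs w hw.1
    set q := 8 * G ^ 2 * κ ^ 2 * entropyConst R * (ermComplexity (finrank ℝ E) n δ / n) with hq
    have hq1 : 1 ≤ q := by
      rw [hq, ← mul_div_assoc, one_le_div hn0]
      exact hnL.le
    refine hlt.not_ge ?_
    calc risk μ f w - minValue (risk μ f) W ≤ G * ‖w - v‖ := by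
          rw [minValue_eq hv.1]
          exact risk_sub_le hf hG hw.1 hv.1.1
      _ ≤ G * (|R| + |R|) := by
          gcongr
          exact (norm_sub_le w v).trans (add_le_add ((hR w hw.1).trans (le_abs_self R))
            ((hR v hv.1.1).trans (le_abs_self R)))
      _ ≤ G * (|R| + |R|) * q ^ 2 := le_mul_of_one_le_right (by positivity) (one_le_pow₀ hq1)
      _ ≤ sharpConst κ G R * (ermComplexity (finrank ℝ E) n δ / n) ^ 2 := by
          have : 0 ≤ 20 * G * (ermComplexity (finrank ℝ E) n δ / n) ^ 2 := by positivity
          rw [hq, sharpConst]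
          linarith

end ErmRates

section Projection

variable {E : Type*} [NormedAddCommGroup E] [InnerProductSpace ℝ E] {K K' W : Set E}

theorem IsNearest.inner_le_zero (hK : Convex ℝ K) {x y u : E} (h : IsNearest K x y) (hu : u ∈ K) :
    inner ℝ (x - y) (u - y) ≤ 0 := by
  refine (norm_eq_iInf_iff_real_inner_le_zero hK h.1).1 ?_ u hu
  have : Nonempty K := ⟨⟨y, h.1⟩⟩
  exact le_antisymm (le_ciInf fun w => h.2 w w.2)
    (ciInf_le ⟨0, forall_mem_range.2 fun w => norm_nonneg _⟩ (⟨y, h.1⟩ : K))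

theorem IsNearest.norm_sub_le (hK : Convex ℝ K) {x y u : E} (h : IsNearest K x y) (hu : u ∈ K) :
    ‖y - u‖ ≤ ‖x - u‖ := by
  have hexpand := norm_sub_sq_real (x - y) (u - y)
  rw [sub_sub_sub_cancel_right, norm_sub_rev u y] at hexpand
  refine le_of_sq_le_sq ?_ (norm_nonneg _)
  linarith [h.inner_le_zero hK hu, sq_nonneg ‖x - y‖]

theorem IsNearest.inner_le_of_near (hK : Convex ℝ K) {x y u y' : E} {η : ℝ} (h : IsNearest K x y)
    (hu : u ∈ K) (hη : ‖u - y'‖ ≤ η) : inner ℝ (x - y) (y' - y) ≤ ‖x - y‖ * η :=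
  calc inner ℝ (x - y) (y' - y) = inner ℝ (x - y) (u - y) + inner ℝ (x - y) (y' - u) := by
        rw [← inner_add_right, sub_add_sub_cancel']
    _ ≤ 0 + ‖x - y‖ * ‖y' - u‖ := add_le_add (h.inner_le_zero hK hu) (real_inner_le_norm _ _)
    _ ≤ ‖x - y‖ * η := by
        rw [zero_add, norm_sub_rev y' u]
        gcongr

theorem IsNearest.norm_sub_sq_le (hK : Convex ℝ K) (hK' : Convex ℝ K') {x y x' y' : E}
    (h : IsNearest K x y) (h' : IsNearest K' x' y') {η : ℝ} (hη : ∃ u ∈ K, ‖u - y'‖ ≤ η)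
    (hη' : ∃ u ∈ K', ‖u - y‖ ≤ η) :
    ‖y - y'‖ ^ 2 ≤ ‖x - x'‖ * ‖y - y'‖ + η * (‖x - y‖ + ‖x' - y'‖) := by
  obtain ⟨u, hu, hle⟩ := hη
  obtain ⟨u', hu', hle'⟩ := hη'
  have hsplit : ‖y - y'‖ ^ 2 = inner ℝ (x - x') (y - y') + inner ℝ (x - y) (y' - y)
      + inner ℝ (x' - y') (y - y') := by
    rw [← neg_sub y y', inner_neg_right, ← sub_eq_add_neg, ← inner_sub_left, ← inner_add_left,
      ← real_inner_self_eq_norm_sq]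
    congr 1
    abel
  linarith [real_inner_le_norm (x - x') (y - y'), h.inner_le_of_near hK hu hle,
    h'.inner_le_of_near hK' hu' hle']

theorem isNearest_proj_of_exists {E : Type*} [NormedAddCommGroup E] {K : Set E} {x : E}
    (h : ∃ y, IsNearest K x y) : IsNearest K x (proj K x) := by
  rw [proj, dif_pos h]
  exact h.choose_spec

theorem isNearest_proj {E : Type*} [NormedAddCommGroup E] [ProperSpace E] {K : Set E}
    (hK : IsClosed K) (hne : K.Nonempty) (x : E) : IsNearest K x (proj K x) :=
  isNearest_proj_of_exists (exists_isNearest hK hne x)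

theorem continuous_proj [ProperSpace E] (hK : IsClosed K) (hne : K.Nonempty) (hc : Convex ℝ K) :
    Continuous (proj K) := by
  have hlip : LipschitzWith 1 (proj K) := LipschitzWith.of_dist_le_mul fun x x' => by
    have h := isNearest_proj hK hne x
    have h' := isNearest_proj hK hne x'
    have hsq := h.norm_sub_sq_le hc hc h' (η := 0) ⟨_, h'.1, by simp⟩ ⟨_, h.1, by simp⟩
    rw [zero_mul, add_zero, sq] at hsq
    rw [dist_eq_norm, dist_eq_norm, NNReal.coe_one, one_mul]
    rcases (norm_nonneg (proj K x - proj K x')).eq_or_lt with h0 | h0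
    · exact h0.symm.trans_le (norm_nonneg _)
    · exact le_of_mul_le_mul_right hsq h0
  exact hlip.continuous

theorem exists_mem_ball_inter_near (hW : Convex ℝ W) {c c' y : E} {r : ℝ} (hr : 0 ≤ r)
    (hc' : c' ∈ W) (hy : y ∈ W ∩ Metric.closedBall c r) :
    ∃ u ∈ W ∩ Metric.closedBall c' r, ‖u - y‖ ≤ ‖c - c'‖ := by
  have hyc : ‖y - c'‖ ≤ r + ‖c - c'‖ :=
    (norm_sub_le_norm_sub_add_norm_sub y c c').trans
      (add_le_add_left (mem_closedBall_iff_norm.1 hy.2) _)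
  rcases (norm_nonneg (c - c')).eq_or_lt with hη | hη
  · exact ⟨y, ⟨hy.1, by rwa [mem_closedBall_iff_norm, ← add_zero r, hη]⟩, by simp⟩
  set η := ‖c - c'‖
  have hs : 0 < r + η := by positivity
  refine ⟨y + (η / (r + η)) • (c' - y), ⟨hW.add_smul_sub_mem hy.1 hc' ⟨by positivity, ?_⟩, ?_⟩, ?_⟩
  · exact (div_le_one hs).2 (le_add_of_nonneg_left hr)
  · have hshrink : y + (η / (r + η)) • (c' - y) - c' = (r / (r + η)) • (y - c') := by
      have : r / (r + η) = 1 - η / (r + η) := by field_simp; ring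
      rw [this]
      module
    rw [mem_closedBall_iff_norm, hshrink, norm_smul, Real.norm_of_nonneg (by positivity),
      div_mul_eq_mul_div, div_le_iff₀ hs]
    gcongr
  · rw [add_sub_cancel_left, norm_smul, Real.norm_of_nonneg (by positivity), div_mul_eq_mul_div,
      div_le_iff₀ hs, norm_sub_rev]
    gcongr

theorem mem_inter_closedBall_self {E : Type*} [NormedAddCommGroup E] {W : Set E} {c : E} {r : ℝ}
    (hc : c ∈ W) (hr : 0 ≤ r) : c ∈ W ∩ Metric.closedBall c r :=
  ⟨hc, Metric.mem_closedBall_self hr⟩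

theorem norm_proj_ball_sub_sq_le [ProperSpace E] (hWc : IsClosed W) (hW : Convex ℝ W) {r : ℝ}
    (hr : 0 ≤ r) {c c' : E} (hc : c ∈ W) (hc' : c' ∈ W) (x x' : E) :
    ‖proj (W ∩ Metric.closedBall c r) x - proj (W ∩ Metric.closedBall c' r) x'‖ ^ 2 ≤
      ‖x - x'‖ * (2 * r + ‖c - c'‖) + ‖c - c'‖ * (‖x - c‖ + ‖x' - c'‖) := by
  have hnear {c : E} (hc : c ∈ W) (x : E) := isNearest_proj
    (hWc.inter Metric.isClosed_closedBall) ⟨c, mem_inter_closedBall_self hc hr⟩ x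
  have hconv (c : E) : Convex ℝ (W ∩ Metric.closedBall c r) := hW.inter (convex_closedBall c r)
  have hy := hnear hc x
  have hy' := hnear hc' x'
  set y := proj (W ∩ Metric.closedBall c r) x
  set y' := proj (W ∩ Metric.closedBall c' r) x'
  have hdist : ‖y - y'‖ ≤ 2 * r + ‖c - c'‖ := by
    have hyc := mem_closedBall_iff_norm.1 hy.1.2
    have hyc' := mem_closedBall_iff_norm'.1 hy'.1.2
    linarith [norm_sub_le_norm_sub_add_norm_sub y c y', norm_sub_le_norm_sub_add_norm_sub c c' y']
  have hstable := hy.norm_sub_sq_le (hconv c) (hconv c') hy' (η := ‖c - c'‖)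
    (norm_sub_rev c c' ▸ exists_mem_ball_inter_near hW hr hc hy'.1)
    (exists_mem_ball_inter_near hW hr hc' hy.1)
  refine hstable.trans ?_
  gcongr
  · exact hy.2 c (mem_inter_closedBall_self hc hr)
  · exact hy'.2 c' (mem_inter_closedBall_self hc' hr)

theorem continuous_proj_ball [ProperSpace E] (hWc : IsClosed W) (hW : Convex ℝ W) {r : ℝ}
    (hr : 0 ≤ r) :
    Continuous fun p : W × E => proj (W ∩ Metric.closedBall (p.1 : E) r) p.2 := by
  refine continuous_iff_continuousAt.2 fun p => tendsto_iff_norm_sub_tendsto_zero.2 ?_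
  have hmodulus : Tendsto (fun q : W × E => ‖q.2 - p.2‖ * (2 * r + ‖(q.1 : E) - p.1‖) +
      ‖(q.1 : E) - p.1‖ * (‖q.2 - q.1‖ + ‖p.2 - p.1‖)) (𝓝 p) (𝓝 0) := by
    have hcont : Continuous fun q : W × E => ‖q.2 - p.2‖ * (2 * r + ‖(q.1 : E) - p.1‖) +
      ‖(q.1 : E) - p.1‖ * (‖q.2 - q.1‖ + ‖p.2 - p.1‖) := by fun_prop
    simpa using hcont.tendsto p
  have hsq := squeeze_zero (fun _ => sq_nonneg _)
    (fun q : W × E => norm_proj_ball_sub_sq_le hWc hW hr q.1.2 p.1.2 q.2 p.2) hmodulus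
  simpa only [Real.sqrt_sq (norm_nonneg _), Real.sqrt_zero] using hsq.sqrt

end Projection

section Oracle

variable {E : Type*} [NormedAddCommGroup E] [InnerProductSpace ℝ E]

/-- The amount, relative to `‖u - w‖`, by which the subgradient inequality of `h` at `w` with slope
`v` fails at `u`. It turns membership in `subdiff` into a limit, to which dominated convergence
applies; at `u = w` it is `0`. -/
def subgradientDefect (h : E → ℝ) (v w u : E) : ℝ :=
  max ((h w + inner ℝ v (u - w) - h u) / ‖u - w‖) 0

theorem add_inner_sub_le_mul_subgradientDefect (h : E → ℝ) (v w u : E) :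
    h w + inner ℝ v (u - w) - h u ≤ ‖u - w‖ * subgradientDefect h v w u := by
  rcases eq_or_ne u w with rfl | hne
  · simp
  · rw [← div_le_iff₀' (norm_pos_iff.2 (sub_ne_zero.2 hne))]
    exact le_max_left _ _

theorem tendsto_subgradientDefect {h : E → ℝ} {W : Set E} {v w : E} (hv : v ∈ subdiff h W w) :
    Tendsto (subgradientDefect h v w) (𝓝[W] w) (𝓝 0) := by
  refine Metric.tendsto_nhds.2 fun ε hε => ?_
  filter_upwards [hv (ε / 2) (half_pos hε)] with u hu
  rw [Real.dist_eq, sub_zero, subgradientDefect, abs_of_nonneg (le_max_right _ _)]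
  refine (max_le ?_ (half_pos hε).le).trans_lt (half_lt_self hε)
  exact div_le_of_le_mul₀ (norm_nonneg _) (half_pos hε).le (by linarith)

theorem norm_subgradientDefect_le {h : E → ℝ} {v w u : E} {G : ℝ} (hv : ‖v‖ ≤ G)
    (hG : |h w - h u| ≤ G * ‖w - u‖) : ‖subgradientDefect h v w u‖ ≤ 2 * G := by
  have hG0 : 0 ≤ G := (norm_nonneg v).trans hv
  rw [subgradientDefect, Real.norm_of_nonneg (le_max_right _ _)]
  refine max_le (div_le_of_le_mul₀ (norm_nonneg _) (by positivity) ?_) (by positivity)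
  have hinner : inner ℝ v (u - w) ≤ G * ‖u - w‖ :=
    (real_inner_le_norm _ _).trans (mul_le_mul_of_nonneg_right hv (norm_nonneg _))
  rw [norm_sub_rev w u] at hG
  linarith [le_abs_self (h w - h u)]

variable [FiniteDimensional ℝ E] {Z : Type*} [MeasurableSpace Z] {μ : Measure Z}
  [IsProbabilityMeasure μ] {f : E → Z → ℝ} {W : Set E} {G : ℝ}

theorem integral_mem_subdiff_risk (hf : ∀ w ∈ W, Integrable (f w) μ) (hG : IsLipschitzLoss f W G)
    {v : Z → E} (hv : Integrable v μ) (hvG : ∀ z, ‖v z‖ ≤ G) {w : E} (hw : w ∈ W)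
    (hsub : ∀ z, v z ∈ subdiff (fun u => f u z) W w) :
    ∫ z, v z ∂μ ∈ subdiff (risk μ f) W w := by
  set defect : E → Z → ℝ := fun u z => subgradientDefect (fun w => f w z) (v z) w u
  have hgap {u : E} (hu : u ∈ W) :
      Integrable (fun z => f w z + inner ℝ (v z) (u - w) - f u z) μ :=
    ((hf w hw).add (hv.inner_const _)).sub (hf u hu)
  have hbound {u : E} (hu : u ∈ W) (z : Z) : ‖defect u z‖ ≤ 2 * G :=
    norm_subgradientDefect_le (hvG z) (hG z w hw u hu)
  have hmeas {u : E} (hu : u ∈ W) : AEStronglyMeasurable (defect u) μ :=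
    (((hgap hu).div_const _).sup (integrable_zero _ _ _)).aestronglyMeasurable
  have hlim : Tendsto (fun u => ∫ z, defect u z ∂μ) (𝓝[W] w) (𝓝 0) := by
    simpa only [integral_zero] using tendsto_integral_filter_of_dominated_convergence
      (fun _ => 2 * G) (eventually_mem_nhdsWithin.mono fun u hu => hmeas hu)
      (eventually_mem_nhdsWithin.mono fun u hu => .of_forall (hbound hu)) (integrable_const _)
      (.of_forall fun z => tendsto_subgradientDefect (hsub z))
  intro ε hε
  filter_upwards [hlim.eventually (ge_mem_nhds hε), self_mem_nhdsWithin] with u hε hu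
  have hint : Integrable (defect u) μ := .of_bound (hmeas hu) (2 * G) (.of_forall (hbound hu))
  have hle : ∫ z, (f w z + inner ℝ (v z) (u - w) - f u z) ∂μ ≤ ‖u - w‖ * ε :=
    calc ∫ z, (f w z + inner ℝ (v z) (u - w) - f u z) ∂μ ≤ ∫ z, ‖u - w‖ * defect u z ∂μ :=
          integral_mono (hgap hu) (hint.const_mul _) fun z =>
            add_inner_sub_le_mul_subgradientDefect (fun w => f w z) (v z) w u
      _ = ‖u - w‖ * ∫ z, defect u z ∂μ := integral_const_mul _ _
      _ ≤ ‖u - w‖ * ε := by gcongr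
  have hmean : ∫ z, inner ℝ (v z) (u - w) ∂μ = inner ℝ (∫ z, v z ∂μ) (u - w) := by
    simp only [real_inner_comm (u - w)]
    exact integral_inner hv _
  rw [integral_sub (f := fun z => f w z + inner ℝ (v z) (u - w))
    ((hf w hw).add (hv.inner_const _)) (hf u hu), integral_add (hf w hw) (hv.inner_const _),
    hmean] at hle
  unfold risk
  linarith

variable [MeasurableSpace E] [BorelSpace E] {g : E → Z → E}

theorem IsSubgradientOracle.integrable (hg : IsSubgradientOracle μ f W G g) {w : E} (hw : w ∈ W) :
    Integrable (g w) μ :=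
  .of_bound (hg.1.comp measurable_prodMk_left).aestronglyMeasurable G (.of_forall (hg.2 w hw).1)

theorem IsSubgradientOracle.integral_mem_subdiff (hg : IsSubgradientOracle μ f W G g)
    (hf : ∀ w ∈ W, Integrable (f w) μ) (hG : IsLipschitzLoss f W G) {w : E} (hw : w ∈ W) :
    ∫ z, g w z ∂μ ∈ subdiff (risk μ f) W w := by
  obtain ⟨hgG, hsub | hmean⟩ := hg.2 w hw
  · exact integral_mem_subdiff_risk hf hG (hg.integrable hw) hgG hw hsub
  · exact hmean

theorem IsSubgradientOracle.risk_sub_le (hg : IsSubgradientOracle μ f W G g)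
    (hf : ∀ w ∈ W, Integrable (f w) μ) (hG : IsLipschitzLoss f W G)
    (hP : ConvexOn ℝ W (risk μ f)) {w u : E} (hw : w ∈ W) (hu : u ∈ W) :
    risk μ f w - risk μ f u ≤ inner ℝ (∫ z, g w z ∂μ) (w - u) := by
  have := (mem_subdiff_iff hP hw).1 (hg.integral_mem_subdiff hf hG hw) u hu
  rw [← neg_sub u w, inner_neg_right]
  linarith

end Oracle

section ProjectedSubgradient

variable {E : Type*} [NormedAddCommGroup E] [InnerProductSpace ℝ E] {Z : Type*} {g : E → Z → E}
  {K W : Set E} {γ G r : ℝ} {w₁ u : E}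

theorem ssgIter_mem [ProperSpace E] (hK : IsClosed K) (hw₁ : w₁ ∈ K) (z : ℕ → Z) (t : ℕ) :
    ssgIter g K γ w₁ z t ∈ K := by
  cases t with
  | zero => exact hw₁
  | succ t => exact (isNearest_proj hK ⟨w₁, hw₁⟩ _).1

theorem ssg_mem [ProperSpace E] (hK : IsClosed K) (hKc : Convex ℝ K) (hw₁ : w₁ ∈ K) (z : ℕ → Z)
    (T : ℕ) : ssg g K γ w₁ z T ∈ K := by
  rw [ssg, Finset.smul_sum]
  refine hKc.sum_mem (fun _ _ => by positivity) ?_ fun t _ => ssgIter_mem hK hw₁ z t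
  simp only [Finset.sum_const, Finset.card_range, nsmul_eq_mul, Nat.cast_add, Nat.cast_one]
  field_simp

theorem dependsOn_ssgIter (t : ℕ) :
    DependsOn (fun z : ℕ → Z => ssgIter g K γ w₁ z t) (Iio t) := fun z z' h => by
  induction t with
  | zero => rfl
  | succ t ih =>
    have hiter : ssgIter g K γ w₁ z t = ssgIter g K γ w₁ z' t :=
      ih fun i hi => h i (Nat.lt_succ_of_lt hi)
    simp only [ssgIter, hiter, h t (Nat.lt_succ_self t)]

theorem dependsOn_ssg (T : ℕ) : DependsOn (fun z : ℕ → Z => ssg g K γ w₁ z T) (Iio T) :=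
  fun _ _ h => congrArg _ <| Finset.sum_congr rfl fun t ht =>
    dependsOn_ssgIter t fun i hi => h i (lt_of_lt_of_le hi (Finset.mem_range_succ_iff.1 ht))

theorem inner_le_of_norm_sub_le {v w : E} (hγ : 0 < γ) (hstep : ‖w - u‖ ≤ ‖v - γ • w₁ - u‖) :
    inner ℝ w₁ (v - u) ≤ (‖v - u‖ ^ 2 - ‖w - u‖ ^ 2) / (2 * γ) + γ * ‖w₁‖ ^ 2 / 2 := by
  have hexpand : ‖v - γ • w₁ - u‖ ^ 2 =
      ‖v - u‖ ^ 2 - 2 * γ * inner ℝ w₁ (v - u) + γ ^ 2 * ‖w₁‖ ^ 2 := by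
    rw [sub_right_comm, norm_sub_sq_real, inner_smul_right, norm_smul,
      Real.norm_of_nonneg hγ.le, real_inner_comm (v - u)]
    ring
  have hsq := pow_le_pow_left₀ (norm_nonneg _) hstep 2
  rw [div_add_div _ _ (by positivity) two_ne_zero, le_div_iff₀ (by positivity)]
  linarith

theorem sum_inner_ssgIter_le [ProperSpace E] (hK : IsClosed K) (hKc : Convex ℝ K) (hγ : 0 < γ)
    (hG : ∀ w ∈ K, ∀ z, ‖g w z‖ ≤ G) (hw₁ : w₁ ∈ K) (hu : u ∈ K) (z : ℕ → Z) (N : ℕ) :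
    ∑ t ∈ Finset.range N, inner ℝ (g (ssgIter g K γ w₁ z t) (z t)) (ssgIter g K γ w₁ z t - u) ≤
      ‖w₁ - u‖ ^ 2 / (2 * γ) + N * (γ * G ^ 2 / 2) := by
  set v := ssgIter g K γ w₁ z
  have hstep (t : ℕ) : inner ℝ (g (v t) (z t)) (v t - u) ≤
      (‖v t - u‖ ^ 2 - ‖v (t + 1) - u‖ ^ 2) / (2 * γ) + γ * G ^ 2 / 2 := by
    refine (inner_le_of_norm_sub_le hγ
      ((isNearest_proj hK ⟨w₁, hw₁⟩ _).norm_sub_le hKc hu)).trans ?_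
    gcongr
    · exact le_rfl
    · exact hG _ (ssgIter_mem hK hw₁ z t) _
  calc ∑ t ∈ Finset.range N, inner ℝ (g (v t) (z t)) (v t - u)
      ≤ ∑ t ∈ Finset.range N,
          ((‖v t - u‖ ^ 2 - ‖v (t + 1) - u‖ ^ 2) / (2 * γ) + γ * G ^ 2 / 2) :=
        Finset.sum_le_sum fun t _ => hstep t
    _ = (‖w₁ - u‖ ^ 2 - ‖v N - u‖ ^ 2) / (2 * γ) + N * (γ * G ^ 2 / 2) := by
        rw [Finset.sum_add_distrib, ← Finset.sum_div, Finset.sum_range_sub', Finset.sum_const,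
          Finset.card_range, nsmul_eq_mul]
        rfl
    _ ≤ ‖w₁ - u‖ ^ 2 / (2 * γ) + N * (γ * G ^ 2 / 2) := by
        gcongr
        exact sub_le_self _ (sq_nonneg _)

theorem ssg_sub_le_sum_div [ProperSpace E] {P : E → ℝ} (hP : ConvexOn ℝ W P) (hK : IsClosed K)
    (hKW : K ⊆ W) (hw₁ : w₁ ∈ K) (z : ℕ → Z) (T : ℕ) (p : ℝ) :
    P (ssg g K γ w₁ z T) - p ≤
      (∑ t ∈ Finset.range (T + 1), (P (ssgIter g K γ w₁ z t) - p)) / (T + 1) := by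
  have hjensen := hP.map_sum_le (t := Finset.range (T + 1)) (w := fun _ => 1 / ((T : ℝ) + 1))
    (p := ssgIter g K γ w₁ z) (fun _ _ => by positivity)
    (by
      simp only [Finset.sum_const, Finset.card_range, nsmul_eq_mul, Nat.cast_add, Nat.cast_one]
      field_simp)
    fun t _ => hKW (ssgIter_mem hK hw₁ z t)
  rw [← Finset.smul_sum] at hjensen
  simp only [smul_eq_mul, ← Finset.mul_sum] at hjensen
  rw [Finset.sum_sub_distrib, Finset.sum_const, Finset.card_range, nsmul_eq_mul, Nat.cast_add_one,
    sub_div, mul_div_cancel_left₀ _ (by positivity), div_eq_inv_mul, ← one_div]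
  exact sub_le_sub_right hjensen p

end ProjectedSubgradient

section GradientNoise

variable {E : Type*} [NormedAddCommGroup E] [InnerProductSpace ℝ E] {Z : Type*}
  [MeasurableSpace Z]

/-- The error, in the direction `w - u`, of the stochastic gradient `g(w, x)` as an estimate of its
mean. Along the iterates these errors form a martingale difference sequence. -/
def gradNoise (μ : Measure Z) (g : E → Z → E) (w u : E) (x : Z) : ℝ :=
  inner ℝ (∫ y, g w y ∂μ - g w x) (w - u)

variable {μ : Measure Z} {g : E → Z → E} {w u : E} {G : ℝ}

theorem measurable_gradNoise [SFinite μ] [FiniteDimensional ℝ E] [MeasurableSpace E] [BorelSpace E]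
    {Ω : Type*} [MeasurableSpace Ω] (hg : Measurable (Function.uncurry g)) {v u : Ω → E} {x : Ω → Z}
    (hv : Measurable v) (hu : Measurable u) (hx : Measurable x) :
    Measurable fun ω => gradNoise μ g (v ω) (u ω) (x ω) := by
  have hmean : Measurable fun w => ∫ y, g w y ∂μ :=
    hg.stronglyMeasurable.integral_prod_right.measurable
  exact ((hmean.comp hv).sub (hg.comp (hv.prodMk hx))).inner (hv.sub hu)

variable [IsProbabilityMeasure μ]

theorem abs_gradNoise_le (hG : ∀ x, ‖g w x‖ ≤ G) (x : Z) :
    |gradNoise μ g w u x| ≤ 2 * G * ‖w - u‖ := by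
  have hmean : ‖∫ y, g w y ∂μ‖ ≤ G := by
    simpa using norm_integral_le_of_norm_le_const (μ := μ) (.of_forall hG)
  refine (abs_real_inner_le_norm _ _).trans ?_
  rw [two_mul]
  gcongr
  exact (norm_sub_le _ _).trans (add_le_add hmean (hG x))

theorem integral_gradNoise [CompleteSpace E] (hg : Integrable (g w) μ) :
    ∫ x, gradNoise μ g w u x ∂μ = 0 := by
  have hint : Integrable (fun x => ∫ y, g w y ∂μ - g w x) μ := (integrable_const _).sub hg
  simp only [gradNoise, real_inner_comm (w - u)]
  rw [integral_inner hint, integral_sub (integrable_const _) hg,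
    integral_const, probReal_univ, one_smul, sub_self, inner_zero_right]

end GradientNoise

section Stage

variable {E : Type*} [NormedAddCommGroup E] [InnerProductSpace ℝ E] {Z : Type*} {W : Set E}
  {g : E → Z → E} {r γ : ℝ} {c u : (ℕ → Z) → E} {t₀ T : ℕ}

/-- The iterates of a stage of ASA with radius `r`, which starts at a random point `c` and consumes
the samples from `t₀` on. -/
def stageIter (g : E → Z → E) (W : Set E) (r γ : ℝ) (c : (ℕ → Z) → E) (t₀ : ℕ) (z : ℕ → Z)
    (t : ℕ) : E :=
  ssgIter g (W ∩ Metric.closedBall (c z) r) γ (c z) (fun i => z (t₀ + i)) t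

/-- The point reached after `T` steps of a stage of ASA; see `stageIter`. -/
def stagePoint (g : E → Z → E) (W : Set E) (r γ : ℝ) (c : (ℕ → Z) → E) (t₀ T : ℕ) (z : ℕ → Z) :
    E :=
  ssg g (W ∩ Metric.closedBall (c z) r) γ (c z) (fun i => z (t₀ + i)) T

theorem dependsOn_stageIter (hc : DependsOn c (Iio t₀)) (t : ℕ) :
    DependsOn (fun z => stageIter g W r γ c t₀ z t) (Iio (t₀ + t)) := fun z z' h => by
  have hcentre : c z = c z' := hc fun i hi => h i (lt_of_lt_of_le hi (Nat.le_add_right _ _))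
  simp only [stageIter, hcentre]
  exact dependsOn_ssgIter t fun i hi => h _ (Nat.add_lt_add_left hi t₀)

theorem dependsOn_stagePoint (hc : DependsOn c (Iio t₀)) :
    DependsOn (stagePoint g W r γ c t₀ T) (Iio (t₀ + T)) := fun z z' h => by
  have hcentre : c z = c z' := hc fun i hi => h i (lt_of_lt_of_le hi (Nat.le_add_right _ _))
  simp only [stagePoint, hcentre]
  exact dependsOn_ssg T fun i hi => h _ (Nat.add_lt_add_left hi t₀)

variable [FiniteDimensional ℝ E]

theorem stageIter_mem (hWc : IsClosed W) (hr : 0 ≤ r) {z : ℕ → Z} (hcW : c z ∈ W) (t : ℕ) :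
    stageIter g W r γ c t₀ z t ∈ W ∩ Metric.closedBall (c z) r :=
  ssgIter_mem (hWc.inter Metric.isClosed_closedBall) (mem_inter_closedBall_self hcW hr) _ t

theorem stagePoint_mem (hWc : IsClosed W) (hW : Convex ℝ W) (hr : 0 ≤ r) {z : ℕ → Z}
    (hcW : c z ∈ W) : stagePoint g W r γ c t₀ T z ∈ W ∩ Metric.closedBall (c z) r :=
  ssg_mem (hWc.inter Metric.isClosed_closedBall) (hW.inter (convex_closedBall _ _))
    (mem_inter_closedBall_self hcW hr) _ T

variable [MeasurableSpace E] [BorelSpace E] [MeasurableSpace Z]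

theorem measurable_stageIter (hWc : IsClosed W) (hW : Convex ℝ W) (hr : 0 ≤ r)
    (hg : Measurable (Function.uncurry g)) (hc : Measurable c) (hcW : ∀ z, c z ∈ W) (t : ℕ) :
    Measurable fun z => stageIter g W r γ c t₀ z t := by
  induction t with
  | zero => exact hc
  | succ t ih =>
    exact (continuous_proj_ball hWc hW hr).measurable.comp ((hc.subtype_mk (h := hcW)).prodMk
      (ih.sub ((hg.comp (ih.prodMk (measurable_pi_apply (t₀ + t)))).const_smul γ)))

theorem measurable_stagePoint (hWc : IsClosed W) (hW : Convex ℝ W) (hr : 0 ≤ r)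
    (hg : Measurable (Function.uncurry g)) (hc : Measurable c) (hcW : ∀ z, c z ∈ W) :
    Measurable (stagePoint g W r γ c t₀ T) :=
  (Finset.measurable_sum (Finset.range (T + 1)) fun t _ =>
    measurable_stageIter (γ := γ) (t₀ := t₀) hWc hW hr hg hc hcW t).const_smul _

variable {μ : Measure Z} [IsProbabilityMeasure μ] {f : E → Z → ℝ} {G : ℝ}

theorem iidLaw_sum_gradNoise_ge_le (hWc : IsClosed W) (hW : Convex ℝ W)
    (hg : IsSubgradientOracle μ f W G g) (hr : 0 ≤ r) (hG : 0 ≤ G) (hc : Measurable c)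
    (hcW : ∀ z, c z ∈ W) (hu : Measurable u) (huK : ∀ z, u z ∈ W ∩ Metric.closedBall (c z) r)
    (hcdep : DependsOn c (Iio t₀)) (hudep : DependsOn u (Iio t₀)) (N : ℕ) {s : ℝ} (hs : 0 ≤ s) :
    iidLaw μ {z | s ≤ ∑ t ∈ Finset.range N,
        gradNoise μ g (stageIter g W r γ c t₀ z t) (u z) (z (t₀ + t))} ≤
      ENNReal.ofReal (Real.exp (-(s ^ 2 / (2 * (N * (4 * G * r) ^ 2))))) := by
  have hvK (t : ℕ) (z : ℕ → Z) := stageIter_mem (g := g) (γ := γ) (t₀ := t₀) hWc hr (hcW z) t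
  refine iidLaw_sum_ge_le_of_abs_le μ t₀
    (X := fun t z => gradNoise μ g (stageIter g W r γ c t₀ z t) (u z))
    (fun t => ?_) (fun t z z' h => ?_) (fun t z x => ?_) (fun t z => ?_) N hs
  · exact measurable_gradNoise hg.1
      ((measurable_stageIter hWc hW hr hg.1 hc hcW t).comp measurable_fst)
      (hu.comp measurable_fst) measurable_snd
  · have hiter : stageIter g W r γ c t₀ z t = stageIter g W r γ c t₀ z' t :=
      dependsOn_stageIter hcdep t h
    have hcomparator : u z = u z' :=
      hudep fun i hi => h i (lt_of_lt_of_le hi (Nat.le_add_right _ _))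
    simp only [hiter, hcomparator]
  · have hdist : ‖stageIter g W r γ c t₀ z t - u z‖ ≤ 2 * r := by
      rw [← dist_eq_norm, two_mul]
      exact (dist_triangle_right _ _ (c z)).trans (add_le_add (hvK t z).2 (huK z).2)
    refine (abs_gradNoise_le (hg.2 _ (hvK t z).1).1 x).trans ?_
    calc 2 * G * ‖stageIter g W r γ c t₀ z t - u z‖ ≤ 2 * G * (2 * r) := by gcongr
      _ = 4 * G * r := by ring
  · exact integral_gradNoise (hg.integrable (hvK t z).1)

theorem risk_stagePoint_sub_le (hWc : IsClosed W) (hf : ∀ w ∈ W, Integrable (f w) μ)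
    (hG0 : 0 < G) (hG : IsLipschitzLoss f W G) (hP : ConvexOn ℝ W (risk μ f))
    (hg : IsSubgradientOracle μ f W G g) (hr : 0 < r) {z : ℕ → Z} (hcW : c z ∈ W)
    (huK : u z ∈ W ∩ Metric.closedBall (c z) r) :
    risk μ f (stagePoint g W r (r / (G * √((T : ℝ) + 1))) c t₀ T z) - risk μ f (u z) ≤
      (r * G * √((T : ℝ) + 1) + ∑ t ∈ Finset.range (T + 1), gradNoise μ g
        (stageIter g W r (r / (G * √((T : ℝ) + 1))) c t₀ z t) (u z) (z (t₀ + t))) / (T + 1) := by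
  set S := √((T : ℝ) + 1)
  have hS : 0 < S := Real.sqrt_pos.2 (by positivity)
  have hSsq : S ^ 2 = T + 1 := Real.sq_sqrt (by positivity)
  set γ := r / (G * S) with hγ
  set v := stageIter g W r γ c t₀ z
  have hKc : IsClosed (W ∩ Metric.closedBall (c z) r) := hWc.inter Metric.isClosed_closedBall
  have hcK := mem_inter_closedBall_self hcW hr.le
  have hv (t : ℕ) : v t ∈ W := (stageIter_mem hWc hr.le hcW t).1
  have hregret : ∑ t ∈ Finset.range (T + 1), inner ℝ (g (v t) (z (t₀ + t))) (v t - u z) ≤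
      r * G * S :=
    calc ∑ t ∈ Finset.range (T + 1), inner ℝ (g (v t) (z (t₀ + t))) (v t - u z)
        ≤ ‖c z - u z‖ ^ 2 / (2 * γ) + (T + 1 : ℕ) * (γ * G ^ 2 / 2) :=
          sum_inner_ssgIter_le hKc (hP.1.inter (convex_closedBall _ _)) (by positivity)
            (fun w hw x => (hg.2 w hw.1).1 x) hcK huK _ _
      _ ≤ r ^ 2 / (2 * γ) + S ^ 2 * (γ * G ^ 2 / 2) := by
          rw [hSsq, Nat.cast_add_one]
          gcongr
          exact mem_closedBall_iff_norm'.1 huK.2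
      _ = r * G * S := by
          rw [hγ]
          field_simp
          ring
  have hexcess (t : ℕ) : risk μ f (v t) - risk μ f (u z) ≤
      inner ℝ (g (v t) (z (t₀ + t))) (v t - u z) + gradNoise μ g (v t) (u z) (z (t₀ + t)) := by
    rw [gradNoise, ← inner_add_left, add_sub_cancel]
    exact hg.risk_sub_le hf hG hP (hv t) huK.1
  refine (ssg_sub_le_sum_div hP hKc inter_subset_left hcK _ T _).trans ?_
  gcongr
  refine (Finset.sum_le_sum fun t _ => hexcess t).trans ?_
  rw [Finset.sum_add_distrib]
  gcongr

theorem iidLaw_stagePoint_le (hWc : IsClosed W) (hf : ∀ w ∈ W, Integrable (f w) μ)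
    (hG0 : 0 < G) (hG : IsLipschitzLoss f W G) (hP : ConvexOn ℝ W (risk μ f))
    (hg : IsSubgradientOracle μ f W G g) (hr : 0 ≤ r) (hc : Measurable c) (hcW : ∀ z, c z ∈ W)
    (hu : Measurable u) (huK : ∀ z, u z ∈ W ∩ Metric.closedBall (c z) r)
    (hcdep : DependsOn c (Iio t₀)) (hudep : DependsOn u (Iio t₀)) {L : ℝ} (hL : 1 ≤ L) :
    iidLaw μ {z | 7 * G * √L / √((T : ℝ) + 1) * r <
        risk μ f (stagePoint g W r (r / (G * √((T : ℝ) + 1))) c t₀ T z) - risk μ f (u z)} ≤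
      ENNReal.ofReal (Real.exp (-L)) := by
  rcases hr.eq_or_lt with rfl | hr
  · have heq (γ : ℝ) (z : ℕ → Z) : stagePoint g W 0 γ c t₀ T z = u z :=
      (Metric.subsingleton_closedBall _ le_rfl) (stagePoint_mem hWc hP.1 le_rfl (hcW z)).2 (huK z).2
    simp [heq]
  have hSsq : √((T : ℝ) + 1) ^ 2 = T + 1 := Real.sq_sqrt (by positivity)
  have hregret (z : ℕ → Z) := risk_stagePoint_sub_le (T := T) (t₀ := t₀) hWc hf hG0 hG hP hg hr
    (hcW z) (huK z)
  set S := √((T : ℝ) + 1)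
  have hS : 0 < S := Real.sqrt_pos.2 (by positivity)
  have hLsq : √L ^ 2 = L := Real.sq_sqrt (by linarith)
  have hL1 : 1 ≤ √L := Real.one_le_sqrt.2 hL
  refine (measure_mono fun z (hz : 7 * G * √L / S * r < _) => ?_).trans <|
    (iidLaw_sum_gradNoise_ge_le (γ := r / (G * S)) hWc hP.1 hg hr.le hG0.le hc hcW hu huK hcdep
      hudep (T + 1) (by positivity : 0 ≤ 6 * G * r * S * √L)).trans ?_
  · have hnoise := hz.trans_le (hregret z)
    rw [← hSsq, lt_div_iff₀ (by positivity)] at hnoise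
    have hthreshold : 7 * G * √L / S * r * S ^ 2 = 7 * (G * r * S * √L) := by
      field_simp
    have hone : G * r * S * 1 ≤ G * r * S * √L := by gcongr
    change 6 * G * r * S * √L ≤ _
    linarith
  · refine ENNReal.ofReal_le_ofReal (Real.exp_le_exp.2 (neg_le_neg ?_))
    have hexponent : (6 * G * r * S * √L) ^ 2 / (2 * ((T + 1 : ℕ) * (4 * G * r) ^ 2)) =
        9 / 8 * L := by
      rw [Nat.cast_add_one, ← hSsq]
      field_simp
      rw [hLsq]
      ring
    linarith

end Stage

section AsaParameters

theorem near_or_le_of_sq_le {e D r α B : ℝ} (hα : 0 ≤ α) (hB : 0 ≤ B) (hr : 0 ≤ r)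
    (he : e ^ 2 ≤ α * D) (hD : D ≤ B * r) : e ≤ r / 2 ∨ D ≤ 8 * α * B ^ 2 - B * r := by
  rcases le_or_gt (4 * α * B) r with hlarge | hsmall
  · refine .inl (le_of_sq_le_sq ?_ (by positivity))
    nlinarith [mul_le_mul_of_nonneg_left hD hα, mul_le_mul_of_nonneg_right hlarge hr]
  · right
    nlinarith [mul_le_mul_of_nonneg_left hsmall.le hB]

/-- As long as the iterate is within the current radius, a stage halves the radius; once it is not,
the excess is already of order `α * B ^ 2`, and the remaining stages add at most a geometric sum. -/
theorem adaptive_stages_le {D e R : ℕ → ℝ} {α B : ℝ} {m : ℕ} (hα : 0 ≤ α) (hB : 0 ≤ B)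
    (hR0 : ∀ k, 0 ≤ R k) (hR : ∀ k, R (k + 1) = R k / 2) (heD : ∀ k, e k ^ 2 ≤ α * D k)
    (h0 : e 0 ≤ R 0) (hnear : ∀ k < m, e k ≤ R k → D (k + 1) ≤ B * R k)
    (hfar : ∀ k < m, R k < e k → D (k + 1) ≤ D k + B * R k) (hm : 1 ≤ m) :
    D m ≤ max (8 * α * B ^ 2) (2 * B * R m) := by
  have hinv : ∀ k ≤ m, e k ≤ R k ∨ D k ≤ 8 * α * B ^ 2 - 2 * B * R k := by
    intro k
    induction k with
    | zero => exact fun _ => .inl h0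
    | succ k ih =>
      intro hk
      have htwice : 2 * B * R (k + 1) = B * R k := by
        rw [hR]
        ring
      rw [htwice, hR]
      rcases le_or_gt (e k) (R k) with hle | hlt
      · exact near_or_le_of_sq_le hα hB (hR0 k) (heD _) (hnear k hk hle)
      · have hsmall := (ih (Nat.le_of_succ_le hk)).resolve_left hlt.not_ge
        exact .inr (by linarith [hfar k hk hlt])
  obtain ⟨k, rfl⟩ := Nat.exists_eq_succ_of_ne_zero (Nat.one_le_iff_ne_zero.1 hm)
  rcases le_or_gt (e k) (R k) with hle | hlt
  · refine le_max_of_le_right ((hnear k k.lt_succ_self hle).trans_eq ?_)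
    rw [hR]
    ring
  · have hsmall := (hinv k k.le_succ).resolve_left hlt.not_ge
    refine le_max_of_le_left ?_
    linarith [hfar k k.lt_succ_self hlt, mul_nonneg hB (hR0 k)]

variable {n : ℕ}

theorem four_le_log (hn : 100 ≤ n) : 4 ≤ Real.log n := by
  have hn' : (100 : ℝ) ≤ n := by exact_mod_cast hn
  calc (4 : ℝ) ≤ 6 * Real.log 2 := by linarith [Real.log_two_gt_d9]
    _ = Real.log (2 ^ 6) := by rw [Real.log_pow]; norm_num
    _ ≤ Real.log n := Real.log_le_log (by positivity) (by linarith)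

theorem two_mul_div_logb_eq (n : ℕ) :
    2 * n / Real.logb 2 n = 2 * n * Real.log 2 / Real.log n := by
  rw [Real.logb, div_div_eq_mul_div]

theorem sixteen_le_two_mul_div_logb (hn : 100 ≤ n) : 16 ≤ 2 * n / Real.logb 2 n := by
  have hn' : (100 : ℝ) ≤ n := by exact_mod_cast hn
  have hlog := four_le_log hn
  have htangent : Real.log n ≤ n / 64 - 1 + 6 * Real.log 2 := by
    have h64 : Real.log 64 = 6 * Real.log 2 := by
      rw [show (64 : ℝ) = 2 ^ 6 by norm_num, Real.log_pow]
      norm_num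
    have := Real.log_le_sub_one_of_pos (by positivity : (0 : ℝ) < n / 64)
    rw [Real.log_div (by positivity) (by norm_num), h64] at this
    linarith
  rw [two_mul_div_logb_eq, le_div_iff₀ (by linarith)]
  nlinarith [Real.log_two_gt_d9, Real.log_two_lt_d9]

theorem half_mul_logb_two (x : ℝ) : 1 / 2 * Real.logb 2 x = Real.logb 4 x := by
  have h4 : Real.log 4 = 2 * Real.log 2 := by
    rw [show (4 : ℝ) = 2 ^ 2 by norm_num, Real.log_pow]
    norm_num
  rw [Real.logb, Real.logb, h4]
  field_simp

theorem two_le_floor_logb (hn : 100 ≤ n) : 2 ≤ ⌊Real.logb 4 (2 * n / Real.logb 2 n)⌋₊ := by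
  have hx := sixteen_le_two_mul_div_logb hn
  refine Nat.le_floor ((Real.le_logb_iff_rpow_le (by norm_num) (by linarith)).2 ?_)
  exact le_trans (by norm_num) hx

theorem asaStages_add_one (hn : 100 ≤ n) :
    asaStages n + 1 = ⌊Real.logb 4 (2 * n / Real.logb 2 n)⌋₊ := by
  rw [asaStages, half_mul_logb_two]
  exact Nat.sub_add_cancel (one_le_two.trans (two_le_floor_logb hn))

theorem one_le_asaStages (hn : 100 ≤ n) : 1 ≤ asaStages n :=
  Nat.le_of_succ_le_succ ((two_le_floor_logb hn).trans_eq (asaStages_add_one hn).symm)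

theorem four_pow_asaStages_le (hn : 100 ≤ n) :
    4 ^ (asaStages n + 1) ≤ 2 * n / Real.logb 2 n := by
  have hx := sixteen_le_two_mul_div_logb hn
  rw [← Real.rpow_natCast, ← Real.le_logb_iff_rpow_le (by norm_num) (by linarith),
    asaStages_add_one hn]
  exact Nat.floor_le (Real.logb_nonneg (by norm_num) (by linarith))

theorem lt_four_pow_asaStages (hn : 100 ≤ n) :
    2 * n / Real.logb 2 n < 4 ^ (asaStages n + 2) := by
  have hx := sixteen_le_two_mul_div_logb hn
  rw [← Real.rpow_natCast, ← Real.logb_lt_iff_lt_rpow (by norm_num) (by linarith),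
    show asaStages n + 2 = asaStages n + 1 + 1 from rfl, Nat.cast_succ, asaStages_add_one hn]
  exact Nat.lt_floor_add_one _

theorem asaStages_le_log (hn : 100 ≤ n) : (asaStages n : ℝ) ≤ Real.log n := by
  have hlog := four_le_log hn
  have hn0 : (0 : ℝ) < n := by positivity
  have hpow : (4 : ℝ) ^ (asaStages n + 1) ≤ 2 * n := by
    refine (four_pow_asaStages_le hn).trans ?_
    rw [two_mul_div_logb_eq, div_le_iff₀ (by linarith)]
    exact mul_le_mul_of_nonneg_left (by linarith [Real.log_two_lt_d9]) (by positivity)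
  have hlogs := Real.log_le_log (by positivity) hpow
  rw [show (4 : ℝ) = 2 ^ 2 by norm_num, ← pow_mul, Real.log_pow, Real.log_mul two_ne_zero hn0.ne']
    at hlogs
  push_cast at hlogs
  nlinarith [Real.log_two_gt_d9, Nat.cast_nonneg (α := ℝ) (asaStages n)]

theorem sqrt_div_log_le_two_pow_asaStages (hn : 100 ≤ n) :
    √(n / Real.log n) ≤ 4 * 2 ^ asaStages n := by
  have hlog := four_le_log hn
  rw [Real.sqrt_le_left (by positivity)]
  calc n / Real.log n ≤ 2 * n / Real.logb 2 n := by
        rw [two_mul_div_logb_eq]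
        gcongr
        nlinarith [Real.log_two_gt_d9, Nat.cast_nonneg (α := ℝ) n]
    _ ≤ 4 ^ (asaStages n + 2) := (lt_four_pow_asaStages hn).le
    _ = (4 * 2 ^ asaStages n) ^ 2 := by
        rw [mul_pow, ← pow_mul, mul_comm (asaStages n) 2, pow_mul]
        norm_num
        ring

theorem div_log_le_asaSteps_add_one (hn : 100 ≤ n) :
    n / Real.log n ≤ (asaSteps n : ℝ) + 1 := by
  have hlog := four_le_log hn
  have hlt : (n : ℝ) < (asaSteps n + 1) * asaStages n := by
    rw [mul_comm]
    exact_mod_cast Nat.lt_mul_div_succ n (one_le_asaStages hn)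
  rw [div_le_iff₀ (by linarith)]
  exact hlt.le.trans (by gcongr; exact asaStages_le_log hn)

theorem asa_rate_le (hn : 100 ≤ n) {α G R₀ L : ℝ} (hα : 0 ≤ α) (hG : 0 ≤ G) (hR₀ : 0 ≤ R₀)
    (hL : 1 ≤ L) :
    max (8 * α * (7 * G * √L / √((asaSteps n : ℝ) + 1)) ^ 2)
      (2 * (7 * G * √L / √((asaSteps n : ℝ) + 1)) * (R₀ / 2 ^ asaStages n)) ≤
      400 * (max (α * G ^ 2) (R₀ * G) * (Real.log n * L) / n) := by
  have hlog := four_le_log hn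
  have hLsq : √L ^ 2 = L := Real.sq_sqrt (by linarith)
  set S := √((asaSteps n : ℝ) + 1)
  set ρ := (n : ℝ) / Real.log n with hρ
  have hρ0 : 0 < ρ := by positivity
  have hρsq : √ρ ^ 2 = ρ := Real.sq_sqrt hρ0.le
  have hSρ : √ρ ≤ S := Real.sqrt_le_sqrt (div_log_le_asaSteps_add_one hn)
  have hrate : Real.log n * L / n = L / ρ := by
    rw [hρ]
    field_simp
  rw [mul_div_assoc (max _ _), hrate, ← mul_assoc]
  refine max_le ?_ ?_
  · calc 8 * α * (7 * G * √L / S) ^ 2 ≤ 8 * α * (7 * G * √L / √ρ) ^ 2 := by gcongr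
      _ = 392 * (α * G ^ 2) * (L / ρ) := by
          rw [div_pow, mul_pow, hLsq, hρsq]
          ring
      _ ≤ 400 * max (α * G ^ 2) (R₀ * G) * (L / ρ) := by
          gcongr
          · norm_num
          · exact le_max_left _ _
  · have hpow := sqrt_div_log_le_two_pow_asaStages hn
    calc 2 * (7 * G * √L / S) * (R₀ / 2 ^ asaStages n)
        ≤ 2 * (7 * G * L / √ρ) * (R₀ / (√ρ / 4)) := by
          gcongr
          · rw [Real.sqrt_le_left (by linarith)]
            nlinarith
          · linarith
      _ = 56 * (R₀ * G) * (L / √ρ ^ 2) := by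
          field_simp
          ring
      _ = 56 * (R₀ * G) * (L / ρ) := by rw [hρsq]
      _ ≤ 400 * max (α * G ^ 2) (R₀ * G) * (L / ρ) := by
          gcongr
          · norm_num
          · exact le_max_right _ _

end AsaParameters

section Asa

theorem convex_argminOn {E : Type*} [AddCommGroup E] [Module ℝ E] {h : E → ℝ} {W : Set E}
    (hh : ConvexOn ℝ W h) : Convex ℝ (argminOn h W) := fun x hx _ hy _ _ ha hb hab =>
  have hxy := hh.convex_le (h x) ⟨hx.1, le_rfl⟩ ⟨hy.1, hy.2 x hx.1⟩ ha hb hab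
  ⟨hxy.1, fun u hu => hxy.2.trans (hx.2 u hu)⟩

section Comparator

variable {E : Type*} [NormedAddCommGroup E] {A W : Set E} {r : ℝ}

open Classical in
/-- The point with which a stage of ASA started at `w` with radius `r` is compared: the point of
`A` nearest to `w` if the stage can reach it, and otherwise `w` itself, which still bounds the loss
incurred by the stage. -/
def comparator (A : Set E) (r : ℝ) (w : E) : E := if ‖w - proj A w‖ ≤ r then proj A w else w

theorem comparator_mem [ProperSpace E] (hA : IsClosed A) (hne : A.Nonempty) (hAW : A ⊆ W)
    (hr : 0 ≤ r) {w : E} (hw : w ∈ W) : comparator A r w ∈ W ∩ Metric.closedBall w r := by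
  unfold comparator
  split_ifs with hnear
  · exact ⟨hAW (isNearest_proj hA hne w).1, mem_closedBall_iff_norm'.2 hnear⟩
  · exact mem_inter_closedBall_self hw hr

theorem measurable_comparator {E : Type*} [NormedAddCommGroup E] [InnerProductSpace ℝ E]
    [FiniteDimensional ℝ E] [MeasurableSpace E] [BorelSpace E] {A : Set E} (hA : IsClosed A)
    (hne : A.Nonempty) (hAc : Convex ℝ A) (r : ℝ) : Measurable (comparator A r) := by
  have hproj := (continuous_proj hA hne hAc).measurable
  exact Measurable.ite (measurableSet_le (measurable_id.sub hproj).norm measurable_const) hproj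
    measurable_id

theorem asa_path_le [ProperSpace E] {P : E → ℝ} (hA : IsClosed (argminOn P W)) {α B R₀ : ℝ}
    (hα : 0 ≤ α) (hebc : EBC P W 1 α) (hB : 0 ≤ B) {a : ℕ → E} (haW : ∀ k, a k ∈ W) {v : E}
    (hv : IsNearest (argminOn P W) (a 0) v) (hvR : ‖a 0 - v‖ ≤ R₀) {m : ℕ} (hm : 1 ≤ m)
    (hstage : ∀ k < m,
      P (a (k + 1)) - P (comparator (argminOn P W) (R₀ / 2 ^ k) (a k)) ≤ B * (R₀ / 2 ^ k)) :
    P (a m) - minValue P W ≤ max (8 * α * B ^ 2) (2 * B * (R₀ / 2 ^ m)) := by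
  have hR₀ : 0 ≤ R₀ := (norm_nonneg _).trans hvR
  have hnearest := isNearest_proj hA ⟨v, hv.1⟩
  refine adaptive_stages_le (D := fun k => P (a k) - minValue P W) (R := fun k => R₀ / 2 ^ k)
    (e := fun k => ‖a k - proj (argminOn P W) (a k)‖) hα hB (fun k => by positivity)
    (fun k => by rw [pow_succ, div_mul_eq_div_div]) (fun k => ?_) ?_ (fun k hk hle => ?_)
    (fun k hk hlt => ?_) hm
  · obtain ⟨y, hy, hle⟩ := hebc (a k) (haW k)
    rw [Real.rpow_one, ← minValue_eq hy.1] at hle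
    refine le_trans ?_ hle
    gcongr
    exact (hnearest _).2 y hy.1
  · rw [pow_zero, div_one]
    exact ((hnearest _).2 v hv.1).trans hvR
  · have hdescent := hstage k hk
    rwa [comparator, if_pos hle, ← minValue_eq (hnearest (a k)).1] at hdescent
  · have hdescent := hstage k hk
    rw [comparator, if_neg hlt.not_ge] at hdescent
    linarith

end Comparator

variable {E : Type*} [NormedAddCommGroup E] [InnerProductSpace ℝ E] {Z : Type*} {W : Set E}
  {g : E → Z → E} {G R₀ : ℝ} {n : ℕ} {w₁ : E}

theorem dependsOn_asaIter (k : ℕ) :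
    DependsOn (fun z : ℕ → Z => asaIter g W G R₀ n w₁ z k) (Iio (k * asaSteps n)) := by
  induction k with
  | zero => exact fun _ _ _ => rfl
  | succ k ih =>
    rw [add_mul, one_mul]
    exact dependsOn_stagePoint ih

variable [FiniteDimensional ℝ E]

theorem asaIter_mem (hWc : IsClosed W) (hW : Convex ℝ W) (hR₀ : 0 ≤ R₀) (hw₁ : w₁ ∈ W)
    (z : ℕ → Z) (k : ℕ) : asaIter g W G R₀ n w₁ z k ∈ W := by
  induction k with
  | zero => exact hw₁
  | succ k ih => exact (stagePoint_mem (c := fun z => asaIter g W G R₀ n w₁ z k)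
      (t₀ := k * asaSteps n) hWc hW (by positivity) ih).1

variable [MeasurableSpace E] [BorelSpace E] [MeasurableSpace Z]

theorem measurable_asaIter (hWc : IsClosed W) (hW : Convex ℝ W)
    (hg : Measurable (Function.uncurry g)) (hR₀ : 0 ≤ R₀) (hw₁ : w₁ ∈ W) (k : ℕ) :
    Measurable fun z : ℕ → Z => asaIter g W G R₀ n w₁ z k := by
  induction k with
  | zero => exact measurable_const
  | succ k ih =>
    exact measurable_stagePoint hWc hW (by positivity) hg ih fun z => asaIter_mem hWc hW hR₀ hw₁ z k

variable {μ : Measure Z} [IsProbabilityMeasure μ] {f : E → Z → ℝ}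

theorem iidLaw_asaIter_succ_le (hWc : IsClosed W) (hf : ∀ w ∈ W, Integrable (f w) μ)
    (hG0 : 0 < G) (hG : IsLipschitzLoss f W G) (hP : ConvexOn ℝ W (risk μ f))
    (hg : IsSubgradientOracle μ f W G g) (hR₀ : 0 ≤ R₀) (hw₁ : w₁ ∈ W) {A : Set E}
    (hA : IsClosed A) (hne : A.Nonempty) (hAc : Convex ℝ A) (hAW : A ⊆ W) {L : ℝ} (hL : 1 ≤ L)
    (k : ℕ) :
    iidLaw μ {z | 7 * G * √L / √((asaSteps n : ℝ) + 1) * (R₀ / 2 ^ k) <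
        risk μ f (asaIter g W G R₀ n w₁ z (k + 1)) -
          risk μ f (comparator A (R₀ / 2 ^ k) (asaIter g W G R₀ n w₁ z k))} ≤
      ENNReal.ofReal (Real.exp (-L)) := by
  have hr : 0 ≤ R₀ / 2 ^ k := by positivity
  have hmeas := measurable_asaIter (G := G) (n := n) hWc hP.1 hg.1 hR₀ hw₁ k
  have haW (z : ℕ → Z) : asaIter g W G R₀ n w₁ z k ∈ W := asaIter_mem hWc hP.1 hR₀ hw₁ z k
  have hdep := dependsOn_asaIter (g := g) (W := W) (G := G) (R₀ := R₀) (n := n) (w₁ := w₁) k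
  exact iidLaw_stagePoint_le hWc hf hG0 hG hP hg hr hmeas haW
    ((measurable_comparator hA hne hAc _).comp hmeas)
    (fun z => comparator_mem hA hne hAW hr (haW z)) hdep
    (fun z z' h => congrArg (comparator A _) (hdep h)) hL

theorem iidLaw_asa_le (hWc : IsClosed W) (hf : ∀ w ∈ W, Integrable (f w) μ) (hG0 : 0 < G)
    (hG : IsLipschitzLoss f W G) (hP : ConvexOn ℝ W (risk μ f)) {α : ℝ} (hα : 0 ≤ α)
    (hebc : EBC (risk μ f) W 1 α) (hg : IsSubgradientOracle μ f W G g) (hw₁ : w₁ ∈ W)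
    (hv : ∃ v, IsNearest (argminOn (risk μ f) W) w₁ v ∧ ‖w₁ - v‖ ≤ R₀) (hn : 100 ≤ n) {δ : ℝ}
    (hδ : 0 < δ) (hδ1 : δ ≤ 1) :
    iidLaw μ {z | 400 * (max (α * G ^ 2) (R₀ * G) *
        (Real.log n * Real.log (Real.log n / δ)) / n) <
      risk μ f (asa g W G R₀ n w₁ z) - minValue (risk μ f) W} ≤ ENNReal.ofReal δ := by
  obtain ⟨v, hv, hvR⟩ := hv
  have hR₀ : 0 ≤ R₀ := (norm_nonneg _).trans hvR
  have hlog := four_le_log hn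
  set L := Real.log (Real.log n / δ) with hL
  have hL1 : 1 ≤ L := by
    rw [hL, Real.le_log_iff_exp_le (by positivity)]
    linarith [Real.exp_one_lt_d9, le_div_self (by linarith : 0 ≤ Real.log n) hδ hδ1]
  have hexpL : Real.exp (-L) ≤ δ / asaStages n := by
    rw [hL, Real.exp_neg, Real.exp_log (by positivity), inv_div]
    have := one_le_asaStages hn
    gcongr
    exact asaStages_le_log hn
  have hA : IsClosed (argminOn (risk μ f) W) := isClosed_argminOn hWc (continuousOn_risk hf hG)
  refine (measure_mono fun z hz => ?_).trans
    (measure_biUnion_finset_le_ofReal (s := Finset.range (asaStages n)) hδ.le (by simp) fun k _ =>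
      (iidLaw_asaIter_succ_le (n := n) hWc hf hG0 hG hP hg hR₀ hw₁ hA ⟨v, hv.1⟩
        (convex_argminOn hP) (fun _ h => h.1) hL1 k).trans (ENNReal.ofReal_le_ofReal hexpL))
  by_contra hgood
  simp only [mem_iUnion, Finset.mem_range, not_exists] at hgood
  have hpath := asa_path_le hA hα hebc (by positivity)
    (fun k => asaIter_mem hWc hP.1 hR₀ hw₁ z k) hv hvR (one_le_asaStages hn)
    fun k hk => not_lt.1 (hgood k hk)
  exact hz.not_ge (hpath.trans (asa_rate_le hn hα hG0.le hR₀ hL1))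

end Asa

section NonnegativeLosses

variable {E Z : Type*} [MeasurableSpace Z] {μ : Measure Z} {f : E → Z → ℝ} {W : Set E}

theorem minValue_risk_nonneg (hf : ∀ w ∈ W, ∀ z, 0 ≤ f w z) : 0 ≤ minValue (risk μ f) W :=
  Real.sInf_nonneg (forall_mem_image.2 fun w hw => integral_nonneg (hf w hw))

theorem sq_le_fast_rate {C L p : ℝ} (hC : 0 ≤ C) (hL : 0 ≤ L) (hp : 0 ≤ p) (n : ℕ) :
    C * (L / n) ^ 2 ≤ C * ((L / n) ^ 2 + L * p / n) :=
  mul_le_mul_of_nonneg_left (le_add_of_nonneg_right (by positivity)) hC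

end NonnegativeLosses
end FastRates

end

open FastRates MeasureTheory Module in
theorem corollary2_general {E Z : Type*} [NormedAddCommGroup E] [InnerProductSpace ℝ E]
    [FiniteDimensional ℝ E] [MeasurableSpace E] [BorelSpace E] [MeasurableSpace Z]
    {μ : Measure Z} [IsProbabilityMeasure μ] {f : E → Z → ℝ} {W : Set E}
    (hf : ∀ w ∈ W, Integrable (f w) μ) :
    (W.Nonempty → IsPolyhedron W → Bornology.IsBounded W → IsPiecewiseLinearOn (risk μ f) W →
      (∃ κ > 0, WeakSharpMinima (risk μ f) W κ) ∧ ∃ α > 0, EBC (risk μ f) W 1 α) ∧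
    ∀ G > 0, IsLipschitzLoss f W G →
      (∀ α > 0, EBC (risk μ f) W 1 α → ∀ R, (∀ w ∈ W, ‖w‖ ≤ R) → ∀ n : ℕ, 2 ≤ n →
        ∀ δ : ℝ, 0 < δ → δ < 1 →
        iidLaw μ {z | ∃ w ∈ argminOn (empRisk f n z) W,
          ermConst α G R * (ermComplexity (finrank ℝ E) n δ / n) <
            risk μ f w - minValue (risk μ f) W} ≤ ENNReal.ofReal δ) ∧
      (IsClosed W → ConvexOn ℝ W (risk μ f) → ∀ α > 0, EBC (risk μ f) W 1 α →
        ∀ g, IsSubgradientOracle μ f W G g → ∀ w₁ ∈ W, ∀ R₀ : ℝ,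
        (∃ v, IsNearest (argminOn (risk μ f) W) w₁ v ∧ ‖w₁ - v‖ ≤ R₀) → ∀ n : ℕ, 100 ≤ n →
        ∀ δ : ℝ, 0 < δ → δ < 1 →
        iidLaw μ {z | 400 * (max (α * G ^ 2) (R₀ * G) *
            (Real.log n * Real.log (Real.log n / δ)) / n) <
          risk μ f (asa g W G R₀ n w₁ z) - minValue (risk μ f) W} ≤ ENNReal.ofReal δ) ∧
      (∀ κ > 0, WeakSharpMinima (risk μ f) W κ → ∀ R, (∀ w ∈ W, ‖w‖ ≤ R) → ∀ n : ℕ, 2 ≤ n →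
        ∀ δ : ℝ, 0 < δ → δ < 1 →
        iidLaw μ {z | ∃ w ∈ argminOn (empRisk f n z) W,
          sharpConst κ G R * (ermComplexity (finrank ℝ E) n δ / n) ^ 2 <
            risk μ f w - minValue (risk μ f) W} ≤ ENNReal.ofReal δ) := by
  refine ⟨fun hne hpoly hb hlin => ?_, fun G hG hlip => ⟨?_, ?_, ?_⟩⟩
  · obtain ⟨κ, hκ, hsharp⟩ := hlin.exists_weakSharpMinima hpoly hb hne
    exact ⟨⟨κ, hκ, hsharp⟩, hsharp.exists_ebc hb hκ⟩
  · intro α hα hebc R hR n hn δ hδ hδ1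
    exact iidLaw_erm_ebc_le hf hG hlip hα hebc hR hn hδ hδ1.le
  · intro hWc hP α hα hebc g hg w₁ hw₁ R₀ hv n hn δ hδ hδ1
    exact iidLaw_asa_le hWc hf hG hlip hP hα.le hebc hg hw₁ hv hn hδ hδ1.le
  · intro κ hκ hsharp R hR n hn δ hδ hδ1
    exact iidLaw_erm_sharp_le hf hG hlip hκ hsharp hR hn hδ hδ1.le

theorem corollary2 :
    ∃ (C₁ : ℝ → ℝ → ℝ → ℝ) (C₂ : ℝ) (C₃ : ℝ → ℝ → ℝ → ℝ),
    ∀ (d : ℕ) (W : Set (EuclideanSpace ℝ (Fin d)))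
      (Z : Type*) [MeasurableSpace Z] (μ : MeasureTheory.Measure Z)
      [MeasureTheory.IsProbabilityMeasure μ] (f : EuclideanSpace ℝ (Fin d) → Z → ℝ),
    W.Nonempty → FastRates.IsPolyhedron W → Bornology.IsBounded W →
    (∀ w ∈ W, MeasureTheory.Integrable (f w) μ) →
    FastRates.IsPiecewiseLinearOn (FastRates.risk μ f) W →
    -- the error bound condition with exponent one, and weak sharp minima
    (∃ κ > 0, FastRates.WeakSharpMinima (FastRates.risk μ f) W κ) ∧
    (∃ α > 0, FastRates.EBC (FastRates.risk μ f) W 1 α) ∧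
    ∀ G > 0, FastRates.IsLipschitzLoss f W G →
      -- empirical risk minimization
      (∀ α > 0, FastRates.EBC (FastRates.risk μ f) W 1 α →
        ∀ R, (∀ w ∈ W, ‖w‖ ≤ R) → ∀ n : ℕ, 2 ≤ n → ∀ δ : ℝ, 0 < δ → δ < 1 →
          FastRates.iidLaw μ {z | ∃ w ∈ FastRates.argminOn (FastRates.empRisk f n z) W,
            C₁ α G R * ((d * Real.log n + Real.log (1 / δ)) / n) <
              FastRates.risk μ f w - FastRates.minValue (FastRates.risk μ f) W}
          ≤ ENNReal.ofReal δ) ∧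
      -- adaptive stochastic approximation
      (ConvexOn ℝ W (FastRates.risk μ f) →
        ∀ α > 0, FastRates.EBC (FastRates.risk μ f) W 1 α →
        ∀ g, FastRates.IsSubgradientOracle μ f W G g →
        ∀ w₁ ∈ W, ∀ R₀ : ℝ,
          (∃ v, FastRates.IsNearest (FastRates.argminOn (FastRates.risk μ f) W) w₁ v ∧
            ‖w₁ - v‖ ≤ R₀) →
          ∀ n : ℕ, 100 ≤ n → ∀ δ : ℝ, 0 < δ → δ < 1 →
          FastRates.iidLaw μ {z |
            C₂ * (max (α * G ^ 2) (R₀ * G) *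
                (Real.log n * Real.log (Real.log n / δ)) / n) <
              FastRates.risk μ f (FastRates.asa g W G R₀ n w₁ z) -
                FastRates.minValue (FastRates.risk μ f) W}
          ≤ ENNReal.ofReal δ) ∧
      -- empirical risk minimization with non-negative linear losses
      ((∀ w ∈ W, ∀ z, 0 ≤ f w z) →
        (∀ z, FastRates.IsAffineOn (fun w => f w z) W) →
        ∀ κ > 0, FastRates.WeakSharpMinima (FastRates.risk μ f) W κ →
        ∀ R, (∀ w ∈ W, ‖w‖ ≤ R) → ∀ n : ℕ, 2 ≤ n →
          C₃ κ G R * (d * Real.log n) ≤ n → ∀ δ : ℝ, 0 < δ → δ < 1 →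
          FastRates.iidLaw μ {z | ∃ w ∈ FastRates.argminOn (FastRates.empRisk f n z) W,
            C₃ κ G R * (((d * Real.log n + Real.log (1 / δ)) / n) ^ 2 +
                (d * Real.log n + Real.log (1 / δ)) *
                  FastRates.minValue (FastRates.risk μ f) W / n) <
              FastRates.risk μ f w - FastRates.minValue (FastRates.risk μ f) W}
          ≤ ENNReal.ofReal δ) := by
  refine ⟨FastRates.ermConst, 400, FastRates.sharpConst,
    fun d W Z _ μ _ f hne hpoly hb hf hlin => ?_⟩
  obtain ⟨hsharp, hrates⟩ := corollary2_general (μ := μ) hf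
  rw [finrank_euclideanSpace_fin] at hrates
  refine ⟨(hsharp hne hpoly hb hlin).1, (hsharp hne hpoly hb hlin).2, fun G hG hlip => ?_⟩
  obtain ⟨herm, hasa, hfast⟩ := hrates G hG hlip
  refine ⟨herm, hasa hpoly.isClosed, fun hpos _ κ hκ hκs R hR n hn _ δ hδ hδ1 => ?_⟩
  refine (MeasureTheory.measure_mono fun z hz => ?_).trans (hfast κ hκ hκs R hR n hn δ hδ hδ1)
  obtain ⟨w, hw, hlt⟩ := hz
  exact ⟨w, hw, hlt.trans_le' (FastRates.sq_le_fast_rate (FastRates.sharpConst_nonneg κ R hG.le)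
    (FastRates.ermComplexity_nonneg d n hδ hδ1.le) (FastRates.minValue_risk_nonneg hpos) n)⟩
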